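/- \textbf{Setting.} Let $(X_j)_{j\ge 0}$ be a Markov chain, $X_j$ taking values in a metric space $(\mathcal X_j,d_j)$ (with its Borel $\sigma$-algebra) of diameter at most $1$, let $P_j(\cdot|x)$, $x\in\mathcal X_{j+1}$, be a probability kernel which is the conditional law of $X_j$ given $X_{j+1}=x$, and let $P_{j,n}(\cdot|x)$, $x\in\mathcal X_{j+n}$, be the law of $(X_j,\dots,X_{j+n-1})$ given $X_{j+n}=x$, obtained by composing $P_{j+n-1},\dots,P_j$. Let $\omega:[0,1]\to[0,1]$ be continuous at $0$ with $\omega(0)=0$, and let $a\in(0,1)$. Assume: (A1) there is $\delta\in(0,1)$ with $\sup_A|P_j(A|x)-P_j(A|y)|\le\delta\,\omega(d_{j+1}(x,y))$ for all $j\ge0$ and $x,y\in\mathcal X_{j+1}$; (A2) there is $n_0\ge1$ such that for all sufficiently small $r>0$, the infimum over $j\ge0$, $b\in\prod_{j\le k<j+n_0}\mathcal X_k$ and $x\in\mathcal X_{j+n_0}$ of $P_{j,n_0}\big(\{y:\max_{j\le k<j+n_0}\omega(d_k(b_k,y_k))\le r\}\,\big|\,x\big)$ is positive. Let $\mathcal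 X_{j,\infty}=\prod_{k\ge j}\mathcal X_k$, let $\kappa_j$ be the law of $(X_j,X_{j+1},\dots)$, let $\omega_j(x,y)=\sup_{n\ge0}a^n\omega(d_{j+n}(x_{j+n},y_{j+n}))$, and for $g:\mathcal X_{j,\infty}\to\mathbb R$ let $\|g\|_{j,\omega}=\|g\|_{L^\infty(\kappa_j)}+\sup_{x\ne y}|g(x)-g(y)|/\omega_j(x,y)$ (with $0/0=0$ and $c/0=\infty$ for $c>0$). For measurable $g_j:\mathcal X_{j,\infty}\to\mathbb R$ put $S_ng=\sum_{j=0}^{n-1}g_j(X_j,X_{j+1},\dots)$. Let $f_j:\mathcal X_{j,\infty}\to\mathbb R$ be measurable with $\sup_j\|f_j\|_{j,\omega}<\infty$, and let $\sigma_n=\|S_nf-\mathbb E[S_nf]\|_{L^2}$. For $h\ne0$ say that a sequence $(f_j)$ is reducible to an $h\mathbb Z$-valued sequence if for all $j$ $$f_j=\kappa_j(f_j)+H_j+hZ_j\qquad(*)$$ on $\mathcal X_{j,\infty}$, with some $Z_j:\mathcal X_{j,\infty}\to\mathbb Z$ and measurable $H_j:\mathcal X_{j,\infty}\to\mathbb R$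 such that $\sup_j\|H_j\|_{j,\omega}<\infty$ and $(S_nH)_{n\ge1}$ is tight. Let $R$ be the set of all such $h\neq0$. The real-valued sequence $(f_j)$ is reducible if $R\ne\emptyset$ and irreducible otherwise; a sequence of $\mathbb Z$-valued functions, regarded as an integer-valued sequence, is reducible if it is reducible to an $h\mathbb Z$-valued sequence for some real $h>1$, and irreducible otherwise. Let $\mathsf H=\{1/r:r\in R\}\cup\{0\}$. \textbf{Theorem.} (i) If $\sigma_n\not\to\infty$ then $\mathsf H=\mathbb R$. (ii) If $(f_j)$ is irreducible then $\mathsf H=\{0\}$. (iii) If $(f_j)$ is reducible and $\sigma_n\to\infty$, then there is $h_0>0$ such that $\mathsf H=h_0\mathbb Z$. Moreover $r_0=1/h_0$ is the largest positive number $r$ such that $(f_j)$ is reducible to an $r\mathbb Z$-valued sequence, and $(f_j)$ can be written in the form $(*)$ with $h=r_0$ and with $(Z_j)$ an irreducible sequence of integer-valued functions. -/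

import Mathlib

open MeasureTheory ProbabilityTheory Filter Topology
open scoped ENNReal

noncomputable section

namespace MarkovShift

universe u v

variable {X : ℕ → Type u} {Ω : Type v}

/-- The space of blocks `(x_j, …, x_{j+n-1})`, i.e. the product of `X k` over `j ≤ k < j + n`. -/
abbrev Block (X : ℕ → Type u) (j n : ℕ) : Type u := (k : Set.Ico j (j + n)) → X k

/-- The space of one-sided paths `(x_j, x_{j+1}, …)`, i.e. the product of `X k` over `k ≥ j`. -/
abbrev Path (X : ℕ → Type u) (j : ℕ) : Type u := (k : Set.Ici j) → X k

/-- `ξ` is a Markov chain with respect to `μ` (the conditional law of the next state given the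
whole past depends on the present state only), and `P j` is the conditional law of `ξ j`
given `ξ (j + 1)`. -/
structure IsMarkovChain [∀ j, MeasurableSpace (X j)] [MeasurableSpace Ω] (μ : Measure Ω)
    (ξ : (j : ℕ) → Ω → X j) (P : (j : ℕ) → Kernel (X (j + 1)) (X j)) : Prop where
  measurable : ∀ j, Measurable (ξ j)
  markov : ∀ (n : ℕ) (A : Set (X (n + 1))), MeasurableSet A →
    μ⟦ξ (n + 1) ⁻¹' A | ⨆ (k : ℕ) (_ : k ≤ n), MeasurableSpace.comap (ξ k) inferInstance⟧
      =ᵐ[μ] μ⟦ξ (n + 1) ⁻¹' A | MeasurableSpace.comap (ξ n) inferInstance⟧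
  condLaw : ∀ j, μ.map (fun w => (ξ (j + 1) w, ξ j w)) = (μ.map (ξ (j + 1))) ⊗ₘ (P j)

/-- Total variation distance, `sup_A |ν₁ A - ν₂ A|`. -/
def tvDist {α : Type*} [MeasurableSpace α] (ν₁ ν₂ : Measure α) : ℝ :=
  ⨆ A : {A : Set α // MeasurableSet A}, |ν₁.real A - ν₂.real A|

/-- Appending the state at time `j + n` to a block over the times `j, …, j + n - 1`. -/
def glue (j n : ℕ) (p : X (j + n) × Block X j n) : Block X j (n + 1) := fun k =>
  if h : (k : ℕ) < j + n then p.2 ⟨k, k.2.1, h⟩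
  else
    have e : j + n = k := le_antisymm (not_lt.mp h) (Nat.lt_succ_iff.mp k.2.2)
    e ▸ p.1

theorem measurable_glue [∀ j, MeasurableSpace (X j)] (j n : ℕ) :
    Measurable (glue (X := X) j n) := by
  refine measurable_pi_lambda _ fun k => ?_
  by_cases h : (k : ℕ) < j + n
  · simp only [glue, h, dite_true]
    exact (measurable_pi_apply _).comp measurable_snd
  · obtain ⟨k, hk⟩ := k
    obtain rfl : k = j + n := le_antisymm (Nat.lt_succ_iff.mp hk.2) (not_lt.mp h)
    simp only [glue, lt_self_iff_false, dite_false]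
    exact measurable_fst

/-- The conditional law of `(ξ j, …, ξ (j + n - 1))` given `ξ (j + n) = x`: run the backward
kernels `P (j + n - 1)`, …, `P j` from `x`. -/
def blockKernel [∀ j, MeasurableSpace (X j)] (P : (j : ℕ) → Kernel (X (j + 1)) (X j)) (j : ℕ) :
    (n : ℕ) → Kernel (X (j + n)) (Block X j n)
  | 0 => Kernel.const _ (Measure.dirac fun k => absurd k.2.2 (not_lt.mpr k.2.1))
  | n + 1 => (P (j + n) ⊗ₖ (blockKernel P j n).comap Prod.snd measurable_snd).map (glue j n)

theorem isMarkovKernel_blockKernel [∀ j, MeasurableSpace (X j)]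
    (P : (j : ℕ) → Kernel (X (j + 1)) (X j)) [∀ j, IsMarkovKernel (P j)] (j n : ℕ) :
    IsMarkovKernel (blockKernel P j n) := by
  induction n with
  | zero => rw [blockKernel]; infer_instance
  | succ n ih => rw [blockKernel]; exact Kernel.IsMarkovKernel.map _ (measurable_glue j n)

section Metric

variable [∀ j, MetricSpace (X j)]

/-- `ω_{j,n}(x, y) = max_{j ≤ k < j + n} ω(d(x_k, y_k))`. -/
def blockModulus (ω : ℝ → ℝ) (j n : ℕ) (x y : Block X j n) : ℝ :=
  ⨆ k : Set.Ico j (j + n), ω (dist (x k) (y k))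

/-- `ω_j(x, y) = sup_{n ≥ 0} a ^ n ω(d(x_{j+n}, y_{j+n}))`. -/
def pathModulus (ω : ℝ → ℝ) (a : ℝ) (j : ℕ) (x y : Path X j) : ℝ :=
  ⨆ n : ℕ, a ^ n * ω (dist (x ⟨j + n, Nat.le_add_right j n⟩) (y ⟨j + n, Nat.le_add_right j n⟩))

/-- The variation `v_{j,ω}(g) = sup_{x ≠ y} |g x - g y| / ω_j(x, y)`, with values in `[0, ∞]`
(here `0 / 0 = 0` and `c / 0 = ∞` for `c > 0`). -/
def variation (ω : ℝ → ℝ) (a : ℝ) (j : ℕ) (g : Path X j → ℝ) : ℝ≥0∞ :=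
  ⨆ (x : Path X j) (y : Path X j) (_ : x ≠ y),
    ENNReal.ofReal |g x - g y| / ENNReal.ofReal (pathModulus ω a j x y)

/-- The backward kernels are equicontinuous with modulus `ω` and contracting. -/
def EquicontinuousKernels [∀ j, MeasurableSpace (X j)] (ω : ℝ → ℝ)
    (P : (j : ℕ) → Kernel (X (j + 1)) (X j)) : Prop :=
  ∃ δ : ℝ, 0 < δ ∧ δ < 1 ∧ ∀ (j : ℕ) (x y : X (j + 1)),
    tvDist (P j x) (P j y) ≤ δ * ω (dist x y)

/-- For some block length `n₀ ≥ 1` and all small `r > 0`, the conditional probabilities of the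
`ω`-balls of radius `r` in the spaces of blocks of length `n₀` are bounded away from `0`. -/
def PositiveBalls [∀ j, MeasurableSpace (X j)] (ω : ℝ → ℝ)
    (P : (j : ℕ) → Kernel (X (j + 1)) (X j)) : Prop :=
  ∃ n₀ : ℕ, 1 ≤ n₀ ∧ ∀ᶠ r : ℝ in 𝓝[>] 0,
    0 < ⨅ (j : ℕ) (b : Block X j n₀) (x : X (j + n₀)),
      blockKernel P j n₀ x {y | blockModulus ω j n₀ b y ≤ r}

variable [∀ j, MeasurableSpace (X j)] [MeasurableSpace Ω]

/-- The law `κ_j` of the path `(ξ j, ξ (j + 1), …)`. -/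
def pathLaw (μ : Measure Ω) (ξ : (j : ℕ) → Ω → X j) (j : ℕ) : Measure (Path X j) :=
  μ.map fun w k => ξ k w

/-- `S_n g = ∑_{j < n} g_j(ξ j, ξ (j + 1), …)`. -/
def partialSum (ξ : (j : ℕ) → Ω → X j) (g : (j : ℕ) → Path X j → ℝ) (n : ℕ) (w : Ω) : ℝ :=
  ∑ j ∈ Finset.range n, g j fun k => ξ k w

/-- `σ_n = ‖S_n g - E[S_n g]‖_{L²}`. -/
def sigma (μ : Measure Ω) (ξ : (j : ℕ) → Ω → X j) (g : (j : ℕ) → Path X j → ℝ) (n : ℕ) : ℝ :=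
  (eLpNorm (fun w => partialSum ξ g n w - ∫ w', partialSum ξ g n w' ∂μ) 2 μ).toReal

/-- `‖g‖_{j,ω} = ‖g‖_{L^∞(κ_j)} + v_{j,ω}(g)`, with values in `[0, ∞]`. -/
def pathNorm (ω : ℝ → ℝ) (a : ℝ) (μ : Measure Ω) (ξ : (j : ℕ) → Ω → X j) (j : ℕ)
    (g : Path X j → ℝ) : ℝ≥0∞ :=
  eLpNorm g ∞ (pathLaw μ ξ j) + variation ω a j g

/-- Measurable functions `g_j` with `sup_j ‖g_j‖_{j,ω} < ∞`. -/
def UniformlyBounded (ω : ℝ → ℝ) (a : ℝ) (μ : Measure Ω) (ξ : (j : ℕ) → Ω → X j)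
    (g : (j : ℕ) → Path X j → ℝ) : Prop :=
  (∀ j, Measurable (g j)) ∧ (⨆ j, pathNorm ω a μ ξ j (g j)) < ∞

/-- `f_j = κ_j(f_j) + H_j + h Z_j` for all `j`, where `Z_j` is integer valued,
`sup_j ‖H_j‖_{j,ω} < ∞`, and the sequence `(S_n H)_{n ≥ 1}` is tight. -/
structure IsReduction (ω : ℝ → ℝ) (a : ℝ) (μ : Measure Ω) (ξ : (j : ℕ) → Ω → X j)
    (f : (j : ℕ) → Path X j → ℝ) (h : ℝ) (H : (j : ℕ) → Path X j → ℝ)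
    (Z : (j : ℕ) → Path X j → ℤ) : Prop where
  bounded : UniformlyBounded ω a μ ξ H
  tight : IsTightMeasureSet ((fun n : ℕ => μ.map (partialSum ξ H n)) '' Set.Ici 1)
  eq : ∀ (j : ℕ) (x : Path X j), f j x = (∫ y, f j y ∂(pathLaw μ ξ j)) + H j x + h * (Z j x : ℝ)

/-- The set `R(f)` of all `h ≠ 0` such that `f` reduces to an `hℤ`-valued sequence. -/
def reductionSteps (ω : ℝ → ℝ) (a : ℝ) (μ : Measure Ω) (ξ : (j : ℕ) → Ω → X j)
    (f : (j : ℕ) → Path X j → ℝ) : Set ℝ :=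
  {h | h ≠ 0 ∧ ∃ H Z, IsReduction ω a μ ξ f h H Z}

/-- Reducibility of a sequence of real-valued functions. -/
def IsReducible (ω : ℝ → ℝ) (a : ℝ) (μ : Measure Ω) (ξ : (j : ℕ) → Ω → X j)
    (f : (j : ℕ) → Path X j → ℝ) : Prop :=
  ∃ h : ℝ, h ≠ 0 ∧ ∃ H Z, IsReduction ω a μ ξ f h H Z

/-- Reducibility of a sequence of integer-valued functions: a reduction with a step `h > 1`. -/
def IsReducibleInt (ω : ℝ → ℝ) (a : ℝ) (μ : Measure Ω) (ξ : (j : ℕ) → Ω → X j)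
    (f : (j : ℕ) → Path X j → ℤ) : Prop :=
  ∃ h : ℝ, 1 < h ∧ ∃ H Z, IsReduction ω a μ ξ (fun j x => (f j x : ℝ)) h H Z

/-- The set `{1 / r : r ∈ R(f)} ∪ {0}`. -/
def corange (ω : ℝ → ℝ) (a : ℝ) (μ : Measure Ω) (ξ : (j : ℕ) → Ω → X j)
    (f : (j : ℕ) → Path X j → ℝ) : Set ℝ :=
  {t | ∃ r ∈ reductionSteps ω a μ ξ f, t = 1 / r} ∪ {0}

end Metric

end MarkovShift

end

open MarkovShift

set_option linter.unusedSectionVars false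

noncomputable section

/-! ### The backward Markov property -/

namespace MarkovShift

/-! Averaging two reductions with weights `s / r` and `s / r'`, where `1 / s = 1 / r + 1 / r'`,
gives a reduction with step `s`. Hence the reciprocals of the steps, together with `0`, form a
subgroup of `ℝ` (`corangeSubgroup`). If the variances grow, this subgroup does not accumulate at `0`
(`exists_reductionSteps_bound`), so it is cyclic. Its positive generator gives the largest step, and
a further reduction of the integer part with some `h > 1` would produce a larger one
(`mul_mem_reductionSteps`). If the variances do not tend to infinity they are bounded, so the
centred sequence itself serves as `H` with `Z = 0`, for every step.

The analysis rests on the chain seen backwards. `P j` is also the conditional law of `ξ j` given the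
entire future, and averaging over it contracts Lipschitz seminorms of a suitable gauge on paths
(`isContractingTower`). Solving a Poisson equation, each centred regular sequence becomes a reverse
martingale difference plus a bounded coboundary. Since martingale differences are orthogonal, their
variances add up, so variances bounded along a subsequence are bounded.

The main estimate is `exists_sum_integral_sq_le`: if at one small frequency the characteristic
functions of the martingale sums, possibly with regular boundary factors, stay away from zero, then
the martingale is bounded in `L²`. The twisted averages eventually become nearly constant, and a
second-order expansion bounds the variance of each step by quantities that telescope. Consequently
tight sums have bounded variances.

To isolate `0`, suppose `r` is a very large step. At the small frequency `2π / r` the integer part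
of the reduction is invisible, so `f` and `H` have the same phases up to constants. The sums of `H`
are tight, hence bounded in `L²`, and the tail of their martingale part is small. So the
characteristic functions for `f`, started late enough, do not decay, and the main estimate bounds
the variances of `f`, a contradiction. -/

/-- A function whose integral vanishes on all intersections of sets of two sigma-algebras has
vanishing integrals on the sets of the sigma-algebra they generate. -/
theorem setIntegral_eq_zero_of_generateFrom {Ω : Type*} {m₀ : MeasurableSpace Ω} {μ : Measure Ω}
    {W : Ω → ℝ} (hW : Integrable W μ) (hW0 : ∫ w, W w ∂μ = 0) {S : Set (Set Ω)}
    (hS : IsPiSystem S) (hS0 : ∀ s ∈ S, MeasurableSet s)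
    (h : ∀ s ∈ S, ∫ w in s, W w ∂μ = 0) (G : Set Ω)
    (hG : MeasurableSet[MeasurableSpace.generateFrom S] G) : ∫ w in G, W w ∂μ = 0 := by
  have hle : MeasurableSpace.generateFrom S ≤ m₀ := MeasurableSpace.generateFrom_le hS0
  induction G, hG using MeasurableSpace.induction_on_inter (s := S) rfl hS with
  | empty => simp
  | basic t ht => exact h t ht
  | compl t htm ih =>
    have := integral_add_compl (hle _ htm) hW
    rw [ih, hW0, zero_add] at this
    exact this
  | iUnion f hd hf ih =>
    rw [integral_iUnion (fun i => hle _ (hf i)) hd hW.integrableOn]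
    simp [ih]

theorem setIntegral_eq_zero_of_sup {Ω : Type*} {m₀ : MeasurableSpace Ω} {μ : Measure Ω}
    {W : Ω → ℝ} (hW : Integrable W μ) {m₁ m₂ : MeasurableSpace Ω} (h₁ : m₁ ≤ m₀) (h₂ : m₂ ≤ m₀)
    (h : ∀ E F, MeasurableSet[m₁] E → MeasurableSet[m₂] F → ∫ w in E ∩ F, W w ∂μ = 0)
    (G : Set Ω) (hG : MeasurableSet[m₁ ⊔ m₂] G) : ∫ w in G, W w ∂μ = 0 := by
  set S : Set (Set Ω) := {s | ∃ E F, MeasurableSet[m₁] E ∧ MeasurableSet[m₂] F ∧ s = E ∩ F}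
  have hle : m₁ ⊔ m₂ ≤ MeasurableSpace.generateFrom S := by
    refine sup_le (fun s hs => ?_) (fun s hs => ?_)
    · exact MeasurableSpace.measurableSet_generateFrom
        ⟨s, Set.univ, hs, MeasurableSet.univ, by simp⟩
    · exact MeasurableSpace.measurableSet_generateFrom
        ⟨Set.univ, s, MeasurableSet.univ, hs, by simp⟩
  refine setIntegral_eq_zero_of_generateFrom hW ?_ (S := S) ?_ ?_ ?_ G (hle _ hG)
  · have := h Set.univ Set.univ MeasurableSet.univ MeasurableSet.univ
    simpa using this
  · rintro _ ⟨E, F, hE, hF, rfl⟩ _ ⟨E', F', hE', hF', rfl⟩ -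
    exact ⟨E ∩ E', F ∩ F', hE.inter hE', hF.inter hF', by rw [Set.inter_inter_inter_comm]⟩
  · rintro _ ⟨E, F, hE, hF, rfl⟩
    exact (h₁ _ hE).inter (h₂ _ hF)
  · rintro _ ⟨E, F, hE, hF, rfl⟩
    exact h E F hE hF

variable {X : ℕ → Type*} [∀ j, MeasurableSpace (X j)] {Ω : Type*} [m₀ : MeasurableSpace Ω]
  {μ : Measure Ω} [IsProbabilityMeasure μ] {ξ : (j : ℕ) → Ω → X j}
  {P : (j : ℕ) → Kernel (X (j + 1)) (X j)} [∀ j, IsMarkovKernel (P j)]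

/-- The sigma-algebra generated by `ξ j, …, ξ (j + n)`. -/
abbrev windowAlgebra (ξ : (j : ℕ) → Ω → X j) (j n : ℕ) : MeasurableSpace Ω :=
  ⨆ k ∈ Set.Icc j (j + n), MeasurableSpace.comap (ξ k) inferInstance

theorem windowAlgebra_zero (j : ℕ) :
    windowAlgebra ξ j 0 = MeasurableSpace.comap (ξ j) inferInstance := by
  simp [windowAlgebra]

theorem windowAlgebra_succ (j n : ℕ) : windowAlgebra ξ j (n + 1) =
    windowAlgebra ξ j n ⊔ MeasurableSpace.comap (ξ (j + n + 1)) inferInstance := by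
  have : Set.Icc j (j + (n + 1)) = Set.Icc j (j + n) ∪ {j + n + 1} := by
    ext k; simp only [Set.mem_Icc, Set.union_singleton, Set.mem_insert_iff]; omega
  rw [windowAlgebra, this, iSup_union, iSup_singleton]

theorem IsMarkovChain.windowAlgebra_le (hξ : IsMarkovChain μ ξ P) (j n : ℕ) :
    windowAlgebra ξ j n ≤ m₀ :=
  iSup₂_le fun k _ => (hξ.measurable k).comap_le

theorem windowAlgebra_mono (j : ℕ) : Monotone (windowAlgebra ξ j) := fun _ _ h =>
  biSup_mono fun _ hk => ⟨hk.1, hk.2.trans (Nat.add_le_add_left h j)⟩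

/-- The deviation of the indicator of `ξ j ∈ A` from its backward conditional probability. -/
abbrev backwardDefect (ξ : (j : ℕ) → Ω → X j) (P : (j : ℕ) → Kernel (X (j + 1)) (X j)) (j : ℕ)
    (A : Set (X j)) (w : Ω) : ℝ :=
  (ξ j ⁻¹' A).indicator (fun _ => (1 : ℝ)) w - (P j (ξ (j + 1) w)).real A

theorem IsMarkovChain.measurable_backwardDefect (hξ : IsMarkovChain μ ξ P) (j : ℕ)
    {A : Set (X j)} (hA : MeasurableSet A) : Measurable (backwardDefect ξ P j A) := by
  refine (measurable_const.indicator (hξ.measurable j hA)).sub ?_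
  exact ((Kernel.measurable_coe (P j) hA).comp (hξ.measurable (j + 1))).ennreal_toReal

theorem IsMarkovChain.integrable_kernel_real (hξ : IsMarkovChain μ ξ P) (j : ℕ)
    {A : Set (X j)} (hA : MeasurableSet A) :
    Integrable (fun w => (P j (ξ (j + 1) w)).real A) μ :=
  Integrable.of_bound (((Kernel.measurable_coe (P j) hA).comp
    (hξ.measurable (j + 1))).ennreal_toReal).aestronglyMeasurable 1 (ae_of_all _ fun w => by
      rw [Real.norm_of_nonneg measureReal_nonneg]; exact measureReal_le_one)

theorem IsMarkovChain.integrable_backwardDefect (hξ : IsMarkovChain μ ξ P) (j : ℕ)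
    {A : Set (X j)} (hA : MeasurableSet A) : Integrable (backwardDefect ξ P j A) μ := by
  refine Integrable.of_bound (hξ.measurable_backwardDefect j hA).aestronglyMeasurable 2
    (ae_of_all _ fun w => ?_)
  have h1 : ‖(ξ j ⁻¹' A).indicator (fun _ => (1 : ℝ)) w‖ ≤ 1 := by
    by_cases h : w ∈ ξ j ⁻¹' A <;> simp [h]
  have h2 : ‖(P j (ξ (j + 1) w)).real A‖ ≤ 1 := by
    rw [Real.norm_of_nonneg measureReal_nonneg]; exact measureReal_le_one
  calc _ ≤ _ := norm_sub_le _ _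
    _ ≤ _ := by linarith

theorem IsMarkovChain.setIntegral_backwardDefect_eq_zero_iff (hξ : IsMarkovChain μ ξ P) (j : ℕ)
    {A : Set (X j)} (hA : MeasurableSet A) (E : Set Ω) :
    ∫ w in E, backwardDefect ξ P j A w ∂μ = 0 ↔
      μ (E ∩ ξ j ⁻¹' A) = ∫⁻ w in E, P j (ξ (j + 1) w) A ∂μ := by
  have hm2 : Measurable fun w => P j (ξ (j + 1) w) A :=
    (Kernel.measurable_coe (P j) hA).comp (hξ.measurable (j + 1))
  have hi := hξ.integrable_kernel_real j hA
  have hi2 : Integrable ((ξ j ⁻¹' A).indicator (fun _ => (1 : ℝ))) μ :=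
    (integrable_const 1).indicator (hξ.measurable j hA)
  rw [integral_sub hi2.integrableOn hi.integrableOn, sub_eq_zero,
    setIntegral_indicator (hξ.measurable j hA)]
  simp only [integral_const, smul_eq_mul, mul_one, Measure.real, Measure.restrict_apply_univ]
  rw [integral_toReal hm2.aemeasurable (ae_of_all _ fun w => measure_lt_top _ _)]
  refine ENNReal.toReal_eq_toReal_iff' (measure_ne_top _ _) ?_
  refine ((lintegral_mono (g := fun _ => 1) fun w => prob_le_one).trans_lt ?_).ne
  simp [measure_lt_top]

theorem IsMarkovChain.setIntegral_backwardDefect_comap (hξ : IsMarkovChain μ ξ P) (j : ℕ)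
    {A : Set (X j)} (hA : MeasurableSet A) {B : Set (X (j + 1))} (hB : MeasurableSet B) :
    ∫ w in ξ (j + 1) ⁻¹' B, backwardDefect ξ P j A w ∂μ = 0 := by
  have hm1 := hξ.measurable (j + 1)
  rw [hξ.setIntegral_backwardDefect_eq_zero_iff j hA]
  have h := congrArg (fun ν => ν (B ×ˢ A)) (hξ.condLaw j)
  rw [Measure.map_apply (hm1.prodMk (hξ.measurable j)) (hB.prod hA),
    Measure.compProd_apply_prod hB hA,
    setLIntegral_map hB (Kernel.measurable_coe (P j) hA) hm1] at h
  exact h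

/-- If `W` is known to the past, `W` integrates to zero on the sets of a sub-algebra `win`, and the
conditional probability of `G` given the past is known to `win`, then `W` integrates to zero on
the intersections with `G`. -/
theorem setIntegral_inter_eq_zero_of_condExp_eq {Ω : Type*} {win past mN : MeasurableSpace Ω}
    [m₀ : MeasurableSpace Ω] {μ : Measure Ω} [IsProbabilityMeasure μ] (hpast : past ≤ m₀)
    (hwp : win ≤ past) (hmN : mN ≤ win) {W : Ω → ℝ} (hWi : Integrable W μ)
    (hWm : StronglyMeasurable[past] W)
    (h0 : ∀ E, MeasurableSet[win] E → ∫ w in E, W w ∂μ = 0) {F : Set Ω} (hF : MeasurableSet F)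
    (hmark : μ⟦F | past⟧ =ᵐ[μ] μ⟦F | mN⟧) {E : Set Ω} (hE : MeasurableSet[win] E) :
    ∫ w in E ∩ F, W w ∂μ = 0 := by
  have hwin : win ≤ m₀ := hwp.trans hpast
  set G : Ω → ℝ := F.indicator fun _ => 1
  have hGi : Integrable G μ := (integrable_const 1).indicator hF
  have hGb : ∀ w, ‖G w‖ ≤ 1 := fun w => by
    by_cases h : w ∈ F <;> simp [G, h]
  set WE : Ω → ℝ := E.indicator W
  have hWEi : Integrable WE μ := hWi.indicator (hwin _ hE)
  have hWEs : StronglyMeasurable[past] WE := hWm.indicator (hwp _ hE)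
  have hprod : Integrable (WE * G) μ := by
    have := hWEi.bdd_mul (f := G) (c := 1) hGi.aestronglyMeasurable (ae_of_all _ hGb)
    simpa [mul_comm, Pi.mul_def] using this
  -- Conditioning on `past` replaces the indicator `G` by `Y`, which is known to `win`. Conditioning
  -- the result on `win` then annihilates `W`.
  set Y : Ω → ℝ := μ[G | mN]
  have hYm : StronglyMeasurable[win] Y := stronglyMeasurable_condExp.mono hmN
  have hae : μ[WE * G | past] =ᵐ[μ] WE * Y := by
    filter_upwards [condExp_mul_of_stronglyMeasurable_left hWEs hprod hGi, hmark] with w h1 h2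
    rw [h1, Pi.mul_apply, Pi.mul_apply, h2]
  have hWEY : Integrable (WE * Y) μ := integrable_condExp.congr hae
  have e1 : ∫ w in E ∩ F, W w ∂μ = ∫ w, (WE * G) w ∂μ := by
    rw [← integral_indicator ((hwin _ hE).inter hF)]
    congr 1; ext w
    by_cases h1 : w ∈ E <;> by_cases h2 : w ∈ F <;> simp [WE, G, h1, h2]
  have e2 : ∫ w, (WE * G) w ∂μ = ∫ w, (WE * Y) w ∂μ := by
    rw [← integral_condExp hpast]
    exact integral_congr_ae hae
  have e3 : μ[W | win] =ᵐ[μ] 0 := by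
    refine (ae_eq_condExp_of_forall_setIntegral_eq hwin hWi (fun s _ _ => ?_)
      (fun s hs _ => ?_) ?_).symm
    · exact integrableOn_zero
    · rw [h0 s hs]; simp
    · exact stronglyMeasurable_zero.aestronglyMeasurable
  have e4 : WE * Y = W * E.indicator Y := by
    ext w; by_cases h1 : w ∈ E <;> simp [WE, h1]
  have hEY : StronglyMeasurable[win] (E.indicator Y) := hYm.indicator hE
  rw [e1, e2]
  rw [e4] at hWEY ⊢
  rw [← integral_condExp hwin]
  refine integral_eq_zero_of_ae ?_
  filter_upwards [condExp_mul_of_stronglyMeasurable_right hEY hWEY hWi, e3] with w h1 h2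
  rw [h1, Pi.mul_apply, h2]; simp

/-- Induction on the length of the window. By the forward Markov property, a new last coordinate
enters only through a conditional probability that depends on the previous last coordinate, and this
is already known to the shorter window. -/
theorem IsMarkovChain.setIntegral_backwardDefect_window (hξ : IsMarkovChain μ ξ P) (j : ℕ)
    {A : Set (X j)} (hA : MeasurableSet A) (n : ℕ) (E : Set Ω)
    (hE : MeasurableSet[windowAlgebra ξ (j + 1) n] E) :
    ∫ w in E, backwardDefect ξ P j A w ∂μ = 0 := by
  have hWi := hξ.integrable_backwardDefect j hA
  induction n generalizing E with
  | zero =>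
    rw [windowAlgebra_zero] at hE
    obtain ⟨B, hB, rfl⟩ := hE
    exact hξ.setIntegral_backwardDefect_comap j hA hB
  | succ n ih =>
    rw [windowAlgebra_succ] at hE
    refine setIntegral_eq_zero_of_sup hWi (hξ.windowAlgebra_le _ _)
      (hξ.measurable _).comap_le ?_ E hE
    rintro E _ hE ⟨B, hB, rfl⟩
    refine setIntegral_inter_eq_zero_of_condExp_eq
      (past := ⨆ (k : ℕ) (_ : k ≤ j + 1 + n), MeasurableSpace.comap (ξ k) inferInstance)
      (iSup₂_le fun k _ => (hξ.measurable k).comap_le) (biSup_mono fun k hk => hk.2)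
      (le_iSup₂_of_le (j + 1 + n) ⟨Nat.le_add_right _ _, le_rfl⟩ le_rfl) hWi ?_ ih
      (hξ.measurable _ hB) (hξ.markov _ B hB) hE
    have hk : ∀ k ≤ j + 1 + n,
        Measurable[⨆ (k : ℕ) (_ : k ≤ j + 1 + n), MeasurableSpace.comap (ξ k) inferInstance]
          (ξ k) := fun k hk =>
      measurable_iff_comap_le.2 (le_iSup₂_of_le (f := fun (k : ℕ) (_ : k ≤ j + 1 + n) =>
        MeasurableSpace.comap (ξ k) inferInstance) k hk le_rfl)
    refine Measurable.stronglyMeasurable (Measurable.sub (Measurable.indicator measurable_const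
      (hk j (by omega) hA)) ?_)
    exact ((Kernel.measurable_coe (P j) hA).comp (hk (j + 1) (by omega))).ennreal_toReal

theorem comap_path_le_iSup_windowAlgebra (j : ℕ) :
    MeasurableSpace.comap (fun w (k : Set.Ici j) => ξ k w) inferInstance
      ≤ ⨆ n, windowAlgebra ξ j n := by
  rw [← measurable_iff_comap_le]
  refine @measurable_pi_lambda _ _ _ (⨆ n, windowAlgebra ξ j n) _ _ fun k => ?_
  obtain ⟨n, hn⟩ := Nat.exists_eq_add_of_le k.2
  refine measurable_iff_comap_le.2 (le_iSup_of_le n ?_)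
  exact le_iSup₂_of_le (f := fun (k : ℕ) (_ : k ∈ Set.Icc j (j + n)) =>
    MeasurableSpace.comap (ξ k) inferInstance) (k : ℕ) ⟨k.2, hn.le⟩ le_rfl

theorem IsMarkovChain.measurable_path (hξ : IsMarkovChain μ ξ P) (j : ℕ) :
    Measurable fun w (k : Set.Ici j) => ξ k w :=
  measurable_pi_lambda _ fun k => hξ.measurable k

/-- The finite windows increase, so their union is a π-system; it generates a sigma-algebra
containing that of the whole future. -/
theorem IsMarkovChain.setIntegral_backwardDefect (hξ : IsMarkovChain μ ξ P) (j : ℕ)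
    {A : Set (X j)} (hA : MeasurableSet A) {B : Set ((k : Set.Ici (j + 1)) → X k)}
    (hB : MeasurableSet B) :
    ∫ w in (fun w (k : Set.Ici (j + 1)) => ξ k w) ⁻¹' B, backwardDefect ξ P j A w ∂μ = 0 := by
  have hE := comap_path_le_iSup_windowAlgebra (ξ := ξ) (j + 1) _ ⟨B, hB, rfl⟩
  rw [← MeasurableSpace.generateFrom_iUnion_measurableSet] at hE
  refine setIntegral_eq_zero_of_generateFrom (hξ.integrable_backwardDefect j hA) ?_
    ?_ ?_ ?_ _ hE
  · have := hξ.setIntegral_backwardDefect_window j hA 0 Set.univ MeasurableSet.univ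
    simpa using this
  · exact isPiSystem_iUnion_of_monotone _
      (fun n => @MeasurableSpace.isPiSystem_measurableSet _ (windowAlgebra ξ (j + 1) n))
      (fun n n' h s hs => windowAlgebra_mono (j + 1) h s hs)
  · rintro s ⟨_, ⟨n, rfl⟩, hs⟩
    exact hξ.windowAlgebra_le _ _ s hs
  · rintro s ⟨_, ⟨n, rfl⟩, hs⟩
    exact hξ.setIntegral_backwardDefect_window j hA n s hs

/-- The backward Markov property: `P j` is also the conditional law of `ξ j` given the whole
future `(ξ (j + 1), ξ (j + 2), …)`. -/
theorem IsMarkovChain.map_path_prod (hξ : IsMarkovChain μ ξ P) (j : ℕ) :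
    μ.map (fun w => ((fun k => ξ k w : (k : Set.Ici (j + 1)) → X k), ξ j w)) =
      (μ.map fun w (k : Set.Ici (j + 1)) => ξ k w) ⊗ₘ
        (P j).comap (fun x : (k : Set.Ici (j + 1)) → X k => x ⟨j + 1, Set.self_mem_Ici⟩)
          (measurable_pi_apply _) := by
  have hp := hξ.measurable_path (j + 1)
  have : IsProbabilityMeasure (μ.map fun w (k : Set.Ici (j + 1)) => ξ k w) :=
    Measure.isProbabilityMeasure_map hp.aemeasurable
  have : IsProbabilityMeasure
      (μ.map (fun w => ((fun k => ξ k w : (k : Set.Ici (j + 1)) → X k), ξ j w))) :=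
    Measure.isProbabilityMeasure_map (hp.prodMk (hξ.measurable j)).aemeasurable
  refine Measure.ext_prod fun {B A} hB hA => ?_
  rw [Measure.map_apply (hp.prodMk (hξ.measurable j)) (hB.prod hA),
    Measure.compProd_apply_prod hB hA, setLIntegral_map hB (Kernel.measurable_coe _ hA) hp]
  exact (hξ.setIntegral_backwardDefect_eq_zero_iff j hA _).1
    (hξ.setIntegral_backwardDefect j hA hB)

end MarkovShift

/-! ### Total variation and oscillation -/

namespace MarkovShift

section TotalVariation

variable {α : Type*} [MeasurableSpace α] {ν₁ ν₂ : Measure α} [IsProbabilityMeasure ν₁]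
  [IsProbabilityMeasure ν₂]

theorem abs_measureReal_sub_le_tvDist {A : Set α} (hA : MeasurableSet A) :
    |ν₁.real A - ν₂.real A| ≤ tvDist ν₁ ν₂ := by
  refine le_ciSup (f := fun A : {A : Set α // MeasurableSet A} => |ν₁.real A - ν₂.real A|)
    ⟨1, ?_⟩ ⟨A, hA⟩
  rintro _ ⟨B, rfl⟩
  have h1 : ν₁.real (B : Set α) ≤ 1 := measureReal_le_one
  have h2 : ν₂.real (B : Set α) ≤ 1 := measureReal_le_one
  have h3 : 0 ≤ ν₁.real (B : Set α) := measureReal_nonneg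
  have h4 : 0 ≤ ν₂.real (B : Set α) := measureReal_nonneg
  exact abs_le.2 ⟨by linarith, by linarith⟩

/-- Layer-cake formula for `g - inf g`, which takes values in `[0, D]`: superlevel sets have
measures differing by at most the total variation distance. Subtracting the infimum is what gives
the constant `D`. -/
theorem abs_integral_sub_integral_le_tvDist {g : α → ℝ} (hg : Measurable g) {D : ℝ}
    (hD : ∀ x y, |g x - g y| ≤ D) :
    |∫ y, g y ∂ν₁ - ∫ y, g y ∂ν₂| ≤ D * tvDist ν₁ ν₂ := by
  have : Nonempty α := nonempty_of_isProbabilityMeasure ν₁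
  obtain ⟨x₀⟩ := this
  have hbdd : BddBelow (Set.range g) :=
    ⟨g x₀ - D, by rintro _ ⟨y, rfl⟩; have := (abs_le.1 (hD x₀ y)).2; linarith⟩
  have : Nonempty α := ⟨x₀⟩
  set c := ⨅ y, g y
  have hc0 : ∀ y, 0 ≤ g y - c := fun y => sub_nonneg.2 (ciInf_le hbdd y)
  have hcD : ∀ y, g y - c ≤ D := fun y => by
    have : g y - D ≤ c := le_ciInf fun z => by have := (abs_le.1 (hD y z)).2; linarith
    linarith
  have hD0 : 0 ≤ D := (hc0 x₀).trans (hcD x₀)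
  have hm : Measurable fun y => g y - c := hg.sub_const c
  have hi : ∀ (ν : Measure α) [IsProbabilityMeasure ν], Integrable (fun y => g y - c) ν :=
    fun ν _ => Integrable.of_bound hm.aestronglyMeasurable D (ae_of_all _ fun y => by
      rw [Real.norm_of_nonneg (hc0 y)]; exact hcD y)
  have hlayer : ∀ (ν : Measure α) [IsProbabilityMeasure ν],
      ∫ y, (g y - c) ∂ν = ∫ t in Set.Ioc 0 D, ν.real {y | t ≤ g y - c} := fun ν _ =>
    (hi ν).integral_eq_integral_Ioc_meas_le (ae_of_all _ hc0) (ae_of_all _ hcD)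
  have hanti : ∀ (ν : Measure α) [IsProbabilityMeasure ν],
      IntegrableOn (fun t => ν.real {y | t ≤ g y - c}) (Set.Ioc 0 D) := fun ν _ => by
    have ha : Antitone fun t => ν.real {y | t ≤ g y - c} := fun s t hst =>
      measureReal_mono fun y hy => hst.trans hy
    exact Integrable.of_bound ha.measurable.aestronglyMeasurable 1 (ae_of_all _ fun t => by
      rw [Real.norm_of_nonneg measureReal_nonneg]; exact measureReal_le_one)
  have hsub : ∀ (ν : Measure α) [IsProbabilityMeasure ν],
      ∫ y, (g y - c) ∂ν = ∫ y, g y ∂ν - c := fun ν _ => by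
    have hgi : Integrable g ν := by
      have := (hi ν).add (integrable_const c)
      refine this.congr (ae_of_all _ fun y => by simp)
    rw [integral_sub hgi (integrable_const c)]; simp
  have e : ∫ y, g y ∂ν₁ - ∫ y, g y ∂ν₂
      = ∫ t in Set.Ioc 0 D, (ν₁.real {y | t ≤ g y - c} - ν₂.real {y | t ≤ g y - c}) := by
    rw [integral_sub (hanti ν₁) (hanti ν₂), ← hlayer, ← hlayer, hsub, hsub]; ring
  rw [e, ← Real.norm_eq_abs]
  have := norm_setIntegral_le_of_norm_le_const (μ := volume) (s := Set.Ioc 0 D)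
    (f := fun t => ν₁.real {y | t ≤ g y - c} - ν₂.real {y | t ≤ g y - c})
    (C := tvDist ν₁ ν₂) (by simp) (fun t _ =>
      abs_measureReal_sub_le_tvDist (measurableSet_le measurable_const hm))
  simpa [hD0, mul_comm] using this

/-- The integrals of a function against two probability measures differ by at most the diameter of
its range times the total variation distance. -/
theorem norm_integral_sub_integral_le_tvDist {g : α → ℂ} (hg : Measurable g) {D : ℝ}
    (hD : ∀ x y, ‖g x - g y‖ ≤ D) :
    ‖∫ y, g y ∂ν₁ - ∫ y, g y ∂ν₂‖ ≤ D * tvDist ν₁ ν₂ := by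
  have : Nonempty α := nonempty_of_isProbabilityMeasure ν₁
  obtain ⟨x₀⟩ := this
  have hi : ∀ (ν : Measure α) [IsProbabilityMeasure ν], Integrable g ν := fun ν _ =>
    Integrable.of_bound hg.aestronglyMeasurable (D + ‖g x₀‖) (ae_of_all _ fun y => by
      calc ‖g y‖ = ‖(g y - g x₀) + g x₀‖ := by rw [sub_add_cancel]
        _ ≤ ‖g y - g x₀‖ + ‖g x₀‖ := norm_add_le _ _
        _ ≤ _ := by linarith [hD y x₀])
  -- A real-linear functional norming the difference of the integrals reduces to the real case
  -- without loss in the constant.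
  obtain ⟨φ, hφ, hφe⟩ := exists_dual_vector'' ℝ (∫ y, g y ∂ν₁ - ∫ y, g y ∂ν₂)
  have h1 := abs_integral_sub_integral_le_tvDist (ν₁ := ν₁) (ν₂ := ν₂)
    (g := fun y => φ (g y)) (φ.continuous.measurable.comp hg) (D := D) (fun x y => by
      rw [← map_sub, ← Real.norm_eq_abs]
      calc ‖φ (g x - g y)‖ ≤ ‖φ‖ * ‖g x - g y‖ := φ.le_opNorm _
        _ ≤ 1 * ‖g x - g y‖ := by gcongr
        _ ≤ D := by rw [one_mul]; exact hD x y)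
  rw [φ.integral_comp_comm (hi ν₁), φ.integral_comp_comm (hi ν₂), ← map_sub, hφe] at h1
  simpa using h1

end TotalVariation

/-! ### Contracting towers -/

/-- A one-sided process `η 0, η 1, …`, where `η (j + 1)` is the image of `η j` under `T j` and
`Q j` disintegrates the law of `η j` over `η (j + 1)`, such that the averaging operators
`g ↦ ∫ g dQ j` contract the Lipschitz seminorms of the gauges `ρ j`. -/
structure IsContractingTower {Y : ℕ → Type*} [∀ j, MeasurableSpace (Y j)] {Ω : Type*}
    [MeasurableSpace Ω] (μ : Measure Ω) (η : (j : ℕ) → Ω → Y j) (T : (j : ℕ) → Y j → Y (j + 1))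
    (Q : (j : ℕ) → Y (j + 1) → Measure (Y j)) (ρ : (j : ℕ) → Y j → Y j → ℝ) (θ C : ℝ) :
    Prop where
  measurable_proc : ∀ j, Measurable (η j)
  measurable_shift : ∀ j, Measurable (T j)
  shift_proc : ∀ j w, T j (η j w) = η (j + 1) w
  prob : ∀ j x, IsProbabilityMeasure (Q j x)
  measurable_average : ∀ j (g : Y j → ℂ), Measurable g → Measurable fun x => ∫ y, g y ∂Q j x
  average_mul : ∀ j x (g : Y j → ℂ) (φ : Y (j + 1) → ℂ), Measurable g → Measurable φ →
    ∫ y, g y * φ (T j y) ∂Q j x = (∫ y, g y ∂Q j x) * φ x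
  disintegration : ∀ j (g : Y j → ℂ) (B : ℝ), Measurable g → (∀ y, ‖g y‖ ≤ B) →
    ∫ w, g (η j w) ∂μ = ∫ w, ∫ y, g y ∂Q j (η (j + 1) w) ∂μ
  gauge_nonneg : ∀ j x y, 0 ≤ ρ j x y
  gauge_le_one : ∀ j x y, ρ j x y ≤ 1
  gauge_shift : ∀ j x y, ρ (j + 1) (T j x) (T j y) ≤ C * ρ j x y
  const_nonneg : 0 ≤ C
  rate_nonneg : 0 ≤ θ
  rate_lt_one : θ < 1
  contract : ∀ j (g : Y j → ℂ) (N : ℝ), Measurable g → 0 ≤ N →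
    (∀ x y, ‖g x - g y‖ ≤ N * ρ j x y) →
    ∀ x y, ‖∫ z, g z ∂Q j x - ∫ z, g z ∂Q j y‖ ≤ θ * N * ρ (j + 1) x y

/-- Families of real functions with uniform sup norm and Lipschitz bounds. -/
structure IsRegularFamily {Y : ℕ → Type*} [∀ j, MeasurableSpace (Y j)]
    (ρ : (j : ℕ) → Y j → Y j → ℝ) (m : (j : ℕ) → Y j → ℝ) (K : ℝ) : Prop where
  measurable : ∀ j, Measurable (m j)
  bound : ∀ j x, |m j x| ≤ K
  lip : ∀ j x y, |m j x - m j y| ≤ K * ρ j x y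

/-- Sequences of functions defining reverse martingale differences. -/
def IsReverseMartingale {Y : ℕ → Type*} [∀ j, MeasurableSpace (Y j)]
    (Q : (j : ℕ) → Y (j + 1) → Measure (Y j)) (m : (j : ℕ) → Y j → ℝ) : Prop :=
  ∀ j x, ∫ y, m j y ∂Q j x = 0

/-- The bounded solutions of the sequential Poisson equation. -/
def corrector {Y : ℕ → Type*} [∀ j, MeasurableSpace (Y j)]
    (Q : (j : ℕ) → Y (j + 1) → Measure (Y j)) (F : (j : ℕ) → Y j → ℝ) : (j : ℕ) → Y j → ℝ
  | 0 => fun _ => 0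
  | j + 1 => fun x => ∫ y, (F j y + corrector Q F j y) ∂Q j x

namespace IsContractingTower

variable {Y : ℕ → Type*} [∀ j, MeasurableSpace (Y j)] {Ω : Type*}
  [MeasurableSpace Ω] {μ : Measure Ω} [IsProbabilityMeasure μ] {η : (j : ℕ) → Ω → Y j}
  {T : (j : ℕ) → Y j → Y (j + 1)} {Q : (j : ℕ) → Y (j + 1) → Measure (Y j)}
  {ρ : (j : ℕ) → Y j → Y j → ℝ} {θ C : ℝ}

theorem integrable_proc (h : IsContractingTower μ η T Q ρ θ C) {j : ℕ} {E : Type*}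
    [NormedAddCommGroup E] [MeasurableSpace E] [BorelSpace E] [SecondCountableTopology E]
    {g : Y j → E} (hg : Measurable g) {B : ℝ} (hB : ∀ y, ‖g y‖ ≤ B) :
    Integrable (fun w => g (η j w)) μ :=
  Integrable.of_bound (hg.comp (h.measurable_proc j)).aestronglyMeasurable B
    (ae_of_all _ fun _ => hB _)

theorem integrable_fiber (h : IsContractingTower μ η T Q ρ θ C) {j : ℕ} (x : Y (j + 1))
    {E : Type*} [NormedAddCommGroup E] [MeasurableSpace E] [BorelSpace E]
    [SecondCountableTopology E] {g : Y j → E} (hg : Measurable g) {B : ℝ}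
    (hB : ∀ y, ‖g y‖ ≤ B) : Integrable g (Q j x) := by
  have := h.prob j x
  exact Integrable.of_bound hg.aestronglyMeasurable B (ae_of_all _ hB)

theorem norm_average_le (h : IsContractingTower μ η T Q ρ θ C) {j : ℕ} (x : Y (j + 1))
    {E : Type*} [NormedAddCommGroup E] [NormedSpace ℝ E] {g : Y j → E} {B : ℝ}
    (hB : ∀ y, ‖g y‖ ≤ B) : ‖∫ y, g y ∂Q j x‖ ≤ B := by
  have := h.prob j x
  simpa using norm_integral_le_of_norm_le_const (μ := Q j x) (ae_of_all _ hB)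

theorem integral_mul_shift (h : IsContractingTower μ η T Q ρ θ C) {j : ℕ} {g : Y j → ℂ}
    (hg : Measurable g) {B : ℝ} (hB : ∀ y, ‖g y‖ ≤ B) {φ : Y (j + 1) → ℂ} (hφ : Measurable φ)
    {B' : ℝ} (hB' : ∀ y, ‖φ y‖ ≤ B') :
    ∫ w, g (η j w) * φ (η (j + 1) w) ∂μ
      = ∫ w, (∫ y, g y ∂Q j (η (j + 1) w)) * φ (η (j + 1) w) ∂μ := by
  have h1 := h.disintegration j (fun y => g y * φ (T j y)) (B * B')
    (hg.mul (hφ.comp (h.measurable_shift j))) (fun y => by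
      rw [norm_mul]
      exact mul_le_mul (hB _) (hB' _) (norm_nonneg _) ((norm_nonneg _).trans (hB y)))
  simp only [h.shift_proc, h.average_mul j _ g φ hg hφ] at h1
  exact h1

theorem measurable_average_real (h : IsContractingTower μ η T Q ρ θ C) {j : ℕ} {g : Y j → ℝ}
    (hg : Measurable g) : Measurable fun x => ∫ y, g y ∂Q j x := by
  have h1 := h.measurable_average j (fun y => (g y : ℂ)) (Complex.measurable_ofReal.comp hg)
  simp only [integral_complex_ofReal] at h1
  exact Complex.measurable_re.comp h1

theorem contract_real (h : IsContractingTower μ η T Q ρ θ C) {j : ℕ} {g : Y j → ℝ} {N : ℝ}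
    (hg : Measurable g) (hN : 0 ≤ N) (hL : ∀ x y, |g x - g y| ≤ N * ρ j x y) (x y : Y (j + 1)) :
    |∫ z, g z ∂Q j x - ∫ z, g z ∂Q j y| ≤ θ * N * ρ (j + 1) x y := by
  have h1 := h.contract j (fun y => (g y : ℂ)) N (Complex.measurable_ofReal.comp hg) hN
    (fun x y => by
      rw [← Complex.ofReal_sub, Complex.norm_real]; exact hL x y) x y
  simp only [integral_complex_ofReal] at h1
  rwa [← Complex.ofReal_sub, Complex.norm_real] at h1

theorem average_mul_real (h : IsContractingTower μ η T Q ρ θ C) {j : ℕ} (x : Y (j + 1))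
    {g : Y j → ℝ} {φ : Y (j + 1) → ℝ} (hg : Measurable g) (hφ : Measurable φ) :
    ∫ y, g y * φ (T j y) ∂Q j x = (∫ y, g y ∂Q j x) * φ x := by
  have h1 := h.average_mul j x (fun y => (g y : ℂ)) (fun y => (φ y : ℂ))
    (Complex.measurable_ofReal.comp hg) (Complex.measurable_ofReal.comp hφ)
  simp only [← Complex.ofReal_mul, integral_complex_ofReal] at h1
  exact_mod_cast h1

theorem disintegration_real (h : IsContractingTower μ η T Q ρ θ C) {j : ℕ} {g : Y j → ℝ}
    (hg : Measurable g) {B : ℝ} (hB : ∀ y, |g y| ≤ B) :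
    ∫ w, g (η j w) ∂μ = ∫ w, ∫ y, g y ∂Q j (η (j + 1) w) ∂μ := by
  have h1 := h.disintegration j (fun y => (g y : ℂ)) B (Complex.measurable_ofReal.comp hg)
    (fun y => by rw [Complex.norm_real]; exact hB y)
  simp only [integral_complex_ofReal] at h1
  exact_mod_cast h1

/-- A function with a Lipschitz bound is uniformly close to its mean. -/
theorem norm_sub_integral_le (h : IsContractingTower μ η T Q ρ θ C) {j : ℕ} {E : Type*}
    [NormedAddCommGroup E] [NormedSpace ℝ E] [CompleteSpace E] [MeasurableSpace E] [BorelSpace E]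
    [SecondCountableTopology E] {g : Y j → E} (hg : Measurable g) {N : ℝ} (hN : 0 ≤ N)
    (hL : ∀ x y, ‖g x - g y‖ ≤ N * ρ j x y) (x : Y j) :
    ‖g x - ∫ w, g (η j w) ∂μ‖ ≤ N := by
  have hosc : ∀ x y, ‖g x - g y‖ ≤ N := fun x y =>
    (hL x y).trans (mul_le_of_le_one_right hN (h.gauge_le_one j x y))
  have hi : Integrable (fun w => g (η j w)) μ := h.integrable_proc hg (B := N + ‖g x‖) fun y => by
    calc ‖g y‖ = ‖(g y - g x) + g x‖ := by rw [sub_add_cancel]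
      _ ≤ ‖g y - g x‖ + ‖g x‖ := norm_add_le _ _
      _ ≤ _ := by linarith [hosc y x]
  have e : g x - ∫ w, g (η j w) ∂μ = ∫ w, (g x - g (η j w)) ∂μ := by
    rw [integral_sub (integrable_const _) hi]; simp
  rw [e]
  simpa using norm_integral_le_of_norm_le_const (μ := μ) (ae_of_all _ fun w => hosc x (η j w))

theorem integral_mul_shift_real (h : IsContractingTower μ η T Q ρ θ C) {j : ℕ} {g : Y j → ℝ}
    (hg : Measurable g) {B : ℝ} (hB : ∀ y, |g y| ≤ B) {φ : Y (j + 1) → ℝ} (hφ : Measurable φ)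
    {B' : ℝ} (hB' : ∀ y, |φ y| ≤ B') :
    ∫ w, g (η j w) * φ (η (j + 1) w) ∂μ
      = ∫ w, (∫ y, g y ∂Q j (η (j + 1) w)) * φ (η (j + 1) w) ∂μ := by
  have h1 := h.integral_mul_shift (j := j) (g := fun y => (g y : ℂ)) (φ := fun y => (φ y : ℂ))
    (Complex.measurable_ofReal.comp hg) (B := B)
    (fun y => by rw [Complex.norm_real]; exact hB y)
    (Complex.measurable_ofReal.comp hφ) (B' := B')
    (fun y => by rw [Complex.norm_real]; exact hB' y)
  simp only [integral_complex_ofReal, ← Complex.ofReal_mul] at h1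
  exact_mod_cast h1

/-- Regularity of the corrector of a centred sequence. -/
theorem corrector_spec (h : IsContractingTower μ η T Q ρ θ C) {F : (j : ℕ) → Y j → ℝ} {K : ℝ}
    (hK : 0 ≤ K) (hF : IsRegularFamily ρ F K) (hF0 : ∀ j, ∫ w, F j (η j w) ∂μ = 0) (j : ℕ) :
    Measurable (corrector Q F j) ∧
      (∀ x y, |corrector Q F j x - corrector Q F j y| ≤ K / (1 - θ) * ρ j x y) ∧
      (∀ x, |corrector Q F j x| ≤ K / (1 - θ)) ∧ ∫ w, corrector Q F j (η j w) ∂μ = 0 := by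
  have hθ : 0 < 1 - θ := sub_pos.2 h.rate_lt_one
  have hU : 0 ≤ K / (1 - θ) := div_nonneg hK hθ.le
  induction j with
  | zero =>
    refine ⟨measurable_const, fun x y => ?_, fun x => ?_, ?_⟩
    · simpa [corrector] using mul_nonneg hU (h.gauge_nonneg 0 x y)
    · simpa [corrector] using hU
    · simp [corrector]
  | succ j ih =>
    obtain ⟨ihm, ihL, ihb, ih0⟩ := ih
    have hmeas : Measurable fun y => F j y + corrector Q F j y := (hF.measurable j).add ihm
    have hm' : Measurable (corrector Q F (j + 1)) := h.measurable_average_real hmeas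
    have hL' : ∀ x y, |corrector Q F (j + 1) x - corrector Q F (j + 1) y|
        ≤ K / (1 - θ) * ρ (j + 1) x y := fun x y => by
      have := h.contract_real (j := j) (N := K + K / (1 - θ)) hmeas (by positivity)
        (fun x y => by
          calc |F j x + corrector Q F j x - (F j y + corrector Q F j y)|
              = |(F j x - F j y) + (corrector Q F j x - corrector Q F j y)| := by ring_nf
            _ ≤ |F j x - F j y| + |corrector Q F j x - corrector Q F j y| := abs_add_le _ _
            _ ≤ _ := by rw [add_mul]; exact add_le_add (hF.lip j x y) (ihL x y)) x y
      refine this.trans (mul_le_mul_of_nonneg_right ?_ (h.gauge_nonneg _ _ _))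
      -- The induction closes because `θ (2 - θ) = 1 - (1 - θ)² ≤ 1`.
      have e : K + K / (1 - θ) = K / (1 - θ) * (2 - θ) := by field_simp; ring
      rw [e]
      have h3 : θ * (2 - θ) ≤ 1 := by nlinarith [sq_nonneg (1 - θ)]
      calc θ * (K / (1 - θ) * (2 - θ)) = K / (1 - θ) * (θ * (2 - θ)) := by ring
        _ ≤ K / (1 - θ) * 1 := by gcongr
        _ = _ := mul_one _
    have h0' : ∫ w, corrector Q F (j + 1) (η (j + 1) w) ∂μ = 0 := by
      have hb : ∀ y, |F j y + corrector Q F j y| ≤ K + K / (1 - θ) := fun y =>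
        (abs_add_le _ _).trans (add_le_add (hF.bound j y) (ihb y))
      have := h.disintegration_real hmeas hb
      rw [integral_add (h.integrable_proc (hF.measurable j) (hF.bound j))
        (h.integrable_proc ihm ihb), hF0, ih0, add_zero] at this
      exact this.symm
    refine ⟨hm', hL', fun x => ?_, h0'⟩
    -- Averaging does not contract sup norms; the sup bound comes from the oscillation bound and the
    -- vanishing mean.
    have := h.norm_sub_integral_le hm' hU hL' x
    rwa [h0', sub_zero] at this

/-- Every centred regular sequence is the sum of a regular reverse martingale difference and a
regular coboundary. -/
theorem exists_martingale_decomposition (h : IsContractingTower μ η T Q ρ θ C)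
    {F : (j : ℕ) → Y j → ℝ} {K : ℝ} (hK : 0 ≤ K) (hF : IsRegularFamily ρ F K)
    (hF0 : ∀ j, ∫ w, F j (η j w) ∂μ = 0) :
    ∃ (m u : (j : ℕ) → Y j → ℝ) (K' : ℝ), 0 ≤ K' ∧ IsRegularFamily ρ m K' ∧
      IsRegularFamily ρ u K' ∧ IsReverseMartingale Q m ∧ (∀ x, u 0 x = 0) ∧
      ∀ j x, F j x = m j x + u (j + 1) (T j x) - u j x := by
  have hθ : 0 < 1 - θ := sub_pos.2 h.rate_lt_one
  have hC := h.const_nonneg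
  set U := K / (1 - θ) with hUdef
  have hU : 0 ≤ U := div_nonneg hK hθ.le
  have hs := h.corrector_spec hK hF hF0
  set u := corrector Q F
  have hT : ∀ j, Measurable fun y => u (j + 1) (T j y) := fun j =>
    (hs (j + 1)).1.comp (h.measurable_shift j)
  refine ⟨fun j y => F j y + u j y - u (j + 1) (T j y), u, K + 2 * U + C * U, by positivity,
    ⟨fun j => ((hF.measurable j).add (hs j).1).sub (hT j), fun j x => ?_, fun j x y => ?_⟩,
    ⟨fun j => (hs j).1, fun j x => ((hs j).2.2.1 x).trans ?_,
      fun j x y => ((hs j).2.1 x y).trans ?_⟩, fun j x => ?_, fun x => rfl, fun j x => ?_⟩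
  · have h1 := hF.bound j x
    have h2 := (hs j).2.2.1 x
    have h3 := (hs (j + 1)).2.2.1 (T j x)
    have h4 : 0 ≤ C * U := mul_nonneg hC hU
    rw [abs_le] at *
    constructor <;> linarith
  · have h1 := hF.lip j x y
    have h2 := (hs j).2.1 x y
    have h3 := ((hs (j + 1)).2.1 (T j x) (T j y)).trans
      (mul_le_mul_of_nonneg_left (h.gauge_shift j x y) hU)
    have h4 : 0 ≤ U * ρ j x y := mul_nonneg hU (h.gauge_nonneg j x y)
    have e : (K + 2 * U + C * U) * ρ j x y
        = K * ρ j x y + 2 * (U * ρ j x y) + U * (C * ρ j x y) := by ring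
    rw [e]
    simp only [← hUdef] at h2 h3
    rw [abs_le] at *
    constructor <;> linarith
  · have h4 : 0 ≤ C * U := mul_nonneg hC hU
    linarith
  · refine mul_le_mul_of_nonneg_right ?_ (h.gauge_nonneg j x y)
    have h4 : 0 ≤ C * U := mul_nonneg hC hU
    linarith
  · have hm1 : Measurable fun y => F j y + u j y := (hF.measurable j).add (hs j).1
    have := h.prob j x
    have hi1 : Integrable (fun y => F j y + u j y) (Q j x) :=
      (h.integrable_fiber x (hF.measurable j) (hF.bound j)).add
        (h.integrable_fiber x (hs j).1 (hs j).2.2.1)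
    have hi2 : Integrable (fun y => u (j + 1) (T j y)) (Q j x) :=
      h.integrable_fiber x (hT j) fun y => (hs (j + 1)).2.2.1 (T j y)
    have e : ∫ y, u (j + 1) (T j y) ∂Q j x = u (j + 1) x := by
      have := h.average_mul_real x (g := fun _ => 1) measurable_const (hs (j + 1)).1
      simpa using this
    rw [integral_sub hi1 hi2, e]
    exact sub_self _
  · ring

theorem sum_eq_sum_martingale_add (h : IsContractingTower μ η T Q ρ θ C)
    {F m u : (j : ℕ) → Y j → ℝ} (hFm : ∀ j x, F j x = m j x + u (j + 1) (T j x) - u j x)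
    (J n : ℕ) (w : Ω) :
    ∑ i ∈ Finset.range n, F (J + i) (η (J + i) w)
      = ∑ i ∈ Finset.range n, m (J + i) (η (J + i) w) + u (J + n) (η (J + n) w)
        - u J (η J w) := by
  induction n with
  | zero => simp
  | succ n ih =>
    rw [Finset.sum_range_succ, Finset.sum_range_succ, ih, hFm, h.shift_proc]
    change _ = _ + u (J + n + 1) (η (J + n + 1) w) - _
    ring

/-- The test function depends on a later variable, which is a function of each earlier one through
the shifts. The last summand averages to zero on the fibres; for the others the shift is absorbed
into `φ`. -/
theorem integral_sum_mul_eq_zero (h : IsContractingTower μ η T Q ρ θ C)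
    {m : (j : ℕ) → Y j → ℝ} {K : ℝ} (hm : IsRegularFamily ρ m K) (hQ : IsReverseMartingale Q m)
    (J n : ℕ) {φ : Y (J + n) → ℝ} (hφ : Measurable φ) {B : ℝ} (hB : ∀ y, |φ y| ≤ B) :
    ∫ w, (∑ i ∈ Finset.range n, m (J + i) (η (J + i) w)) * φ (η (J + n) w) ∂μ = 0 := by
  induction n with
  | zero => simp
  | succ n ih =>
    have hφT : Measurable fun y => φ (T (J + n) y) := hφ.comp (h.measurable_shift _)
    have h1 := ih (φ := fun y => φ (T (J + n) y)) hφT (fun y => hB _)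
    simp only [h.shift_proc] at h1
    have h2 := h.integral_mul_shift_real (hm.measurable (J + n)) (hm.bound (J + n)) hφ hB
    have e0 : ∀ x, ∫ y, m (J + n) y ∂Q (J + n) x = 0 := hQ (J + n)
    simp only [e0, zero_mul, integral_zero] at h2
    have hφi : AEStronglyMeasurable (fun w => φ (η (J + n + 1) w)) μ :=
      (hφ.comp (h.measurable_proc _)).aestronglyMeasurable
    have hi : ∀ k, Integrable (fun w => m k (η k w) * φ (η (J + n + 1) w)) μ := fun k =>
      (h.integrable_proc (hm.measurable k) (hm.bound k)).mul_bdd hφi (ae_of_all _ fun w => hB _)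
    have hsum : Integrable (fun w => (∑ i ∈ Finset.range n, m (J + i) (η (J + i) w))
        * φ (η (J + n + 1) w)) μ := by
      simp only [Finset.sum_mul]
      exact integrable_finsetSum _ fun i _ => hi _
    simp only [Finset.sum_range_succ, add_mul]
    exact (integral_add hsum (hi (J + n))).trans (by rw [h1, h2, add_zero])

theorem integrable_sum (h : IsContractingTower μ η T Q ρ θ C)
    {m : (j : ℕ) → Y j → ℝ} {K : ℝ} (hm : IsRegularFamily ρ m K) (J n : ℕ) :
    Integrable (fun w => ∑ i ∈ Finset.range n, m (J + i) (η (J + i) w)) μ :=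
  integrable_finsetSum _ fun _ _ => h.integrable_proc (hm.measurable _) (hm.bound _)

theorem abs_sum_le {m : (j : ℕ) → Y j → ℝ} {K : ℝ} (hm : IsRegularFamily ρ m K)
    (J n : ℕ) (w : Ω) : |∑ i ∈ Finset.range n, m (J + i) (η (J + i) w)| ≤ n * K := by
  refine (Finset.abs_sum_le_sum_abs _ _).trans ?_
  simpa using Finset.sum_le_card_nsmul (Finset.range n) _ K fun i _ => hm.bound _ _

theorem measurable_sum (h : IsContractingTower μ η T Q ρ θ C)
    {m : (j : ℕ) → Y j → ℝ} {K : ℝ} (hm : IsRegularFamily ρ m K) (J n : ℕ) :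
    Measurable fun w => ∑ i ∈ Finset.range n, m (J + i) (η (J + i) w) :=
  Finset.measurable_sum _ fun _ _ => (hm.measurable _).comp (h.measurable_proc _)

/-- Orthogonality of reverse martingale differences. -/
theorem integral_sum_sq (h : IsContractingTower μ η T Q ρ θ C)
    {m : (j : ℕ) → Y j → ℝ} {K : ℝ} (hm : IsRegularFamily ρ m K) (hQ : IsReverseMartingale Q m)
    (J n : ℕ) :
    ∫ w, (∑ i ∈ Finset.range n, m (J + i) (η (J + i) w)) ^ 2 ∂μ
      = ∑ i ∈ Finset.range n, ∫ w, m (J + i) (η (J + i) w) ^ 2 ∂μ := by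
  induction n with
  | zero => simp
  | succ n ih =>
    have h1 := h.integral_sum_mul_eq_zero hm hQ J n (hm.measurable (J + n)) (hm.bound (J + n))
    have hmi := h.integrable_proc (hm.measurable (J + n)) (hm.bound (J + n))
    have hi1 : Integrable
        (fun w => (∑ i ∈ Finset.range n, m (J + i) (η (J + i) w)) ^ 2) μ := by
      simp only [sq]
      exact (h.integrable_sum hm J n).mul_bdd
        (h.integrable_sum hm J n).aestronglyMeasurable (ae_of_all _ fun w => abs_sum_le hm J n w)
    have hi2 : Integrable (fun w => (∑ i ∈ Finset.range n, m (J + i) (η (J + i) w))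
        * m (J + n) (η (J + n) w)) μ :=
      (h.integrable_sum hm J n).mul_bdd hmi.aestronglyMeasurable
        (ae_of_all _ fun w => hm.bound _ _)
    have hi3 : Integrable (fun w => m (J + n) (η (J + n) w) ^ 2) μ := by
      simp only [sq]
      exact hmi.mul_bdd hmi.aestronglyMeasurable (ae_of_all _ fun w => hm.bound _ _)
    simp only [Finset.sum_range_succ, add_sq, mul_assoc]
    have e1 := integral_add (hi1.add (hi2.const_mul 2)) hi3
    have e2 := integral_add hi1 (hi2.const_mul 2)
    rw [integral_const_mul, h1, ih, mul_zero, add_zero] at e2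
    simp only [Pi.add_apply] at e1
    rw [e1, e2]

end IsContractingTower

end MarkovShift

/-! ### Decay of characteristic functions at small frequencies -/

namespace MarkovShift

/-- The cone `V ≤ A / 4` is invariant under the recursion. Outside it `A < 4 V`, so `V` decays
geometrically with ratio `(1 + θ) / 2`, and `A + V < 5 V` would eventually drop below `κ`. Thus the
cone is entered. -/
theorem eventually_le_of_contraction {A V : ℕ → ℝ} {θ τ κ : ℝ} (hA : ∀ n, 0 ≤ A n)
    (hV : ∀ n, 0 ≤ V n) (hθ0 : 0 ≤ θ) (hθ1 : θ < 1) (hτ0 : 0 ≤ τ) (hτ : τ ≤ (1 - θ) / 16)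
    (hstepV : ∀ n, V (n + 1) ≤ θ * ((1 + τ) * V n + τ * A n))
    (hstepA : ∀ n, A n - τ * (A n + V n) ≤ A (n + 1)) (hκ : 0 < κ) (hlow : ∀ n, κ ≤ A n + V n) :
    ∃ n₁, ∀ n ≥ n₁, V n ≤ A n / 4 := by
  have hinv : ∀ n, V n ≤ A n / 4 → V (n + 1) ≤ A (n + 1) / 4 := fun n hn => by
    have h1 : V (n + 1) ≤ θ * ((1 + τ) * (A n / 4) + τ * A n) :=
      (hstepV n).trans (by gcongr)
    have h2 : A n - τ * (A n + A n / 4) ≤ A (n + 1) := by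
      refine le_trans ?_ (hstepA n)
      gcongr
    have h3 : 0 ≤ A n * ((1 - θ) - 16 * τ) := mul_nonneg (hA n) (by linarith)
    have h4 : 0 ≤ τ * A n := mul_nonneg hτ0 (hA n)
    have h5 : 0 ≤ (1 - θ) * (τ * A n) := mul_nonneg (by linarith) h4
    nlinarith
  by_cases hex : ∃ n₁, V n₁ ≤ A n₁ / 4
  · obtain ⟨n₁, h₁⟩ := hex
    exact ⟨n₁, fun n hn => Nat.le_induction h₁ (fun k _ hk => hinv k hk) n hn⟩
  · push Not at hex
    exfalso
    have hgeo : ∀ n, V n ≤ ((1 + θ) / 2) ^ n * V 0 := fun n => by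
      induction n with
      | zero => simp
      | succ n ih =>
        have h1 : V (n + 1) ≤ θ * ((1 + τ) * V n + τ * (4 * V n)) :=
          (hstepV n).trans (by gcongr; linarith [hex n])
        have h2 : θ * ((1 + τ) * V n + τ * (4 * V n)) ≤ (1 + θ) / 2 * V n := by
          have e : θ * ((1 + τ) * V n + τ * (4 * V n)) = θ * (1 + 5 * τ) * V n := by ring
          rw [e]
          refine mul_le_mul_of_nonneg_right ?_ (hV n)
          nlinarith
        calc V (n + 1) ≤ (1 + θ) / 2 * V n := h1.trans h2
          _ ≤ (1 + θ) / 2 * (((1 + θ) / 2) ^ n * V 0) := by gcongr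
          _ = _ := by ring
    have hlim : Tendsto (fun n : ℕ => ((1 + θ) / 2) ^ n * V 0) atTop (𝓝 0) := by
      simpa using (tendsto_pow_atTop_nhds_zero_of_lt_one (r := (1 + θ) / 2)
        (by linarith) (by linarith)).mul_const (V 0)
    obtain ⟨n, hn⟩ := (hlim.eventually (gt_mem_nhds (show (0 : ℝ) < κ / 5 by positivity))).exists
    have := hgeo n
    have := hex n
    have := hlow n
    linarith

/-- The unit complex number with argument `x`. -/
abbrev phase (x : ℝ) : ℂ := Complex.exp (Complex.I * (x : ℂ))

theorem norm_phase (x : ℝ) : ‖phase x‖ = 1 := Complex.norm_exp_I_mul_ofReal x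

theorem phase_add (x y : ℝ) : phase (x + y) = phase x * phase y := by
  rw [phase, Complex.ofReal_add, mul_add, Complex.exp_add]

theorem phase_zero : phase 0 = 1 := by simp [phase]

theorem norm_phase_sub_one_le (x : ℝ) : ‖phase x - 1‖ ≤ |x| :=
  Real.norm_exp_I_mul_ofReal_sub_one_le

theorem phase_neg_mul_phase (x : ℝ) : phase (-x) * phase x = 1 := by
  rw [← phase_add, neg_add_cancel, phase_zero]

theorem norm_phase_sub_phase_le (x y : ℝ) : ‖phase x - phase y‖ ≤ |x - y| := by
  have : phase x - phase y = (phase (x - y) - 1) * phase y := by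
    rw [sub_mul, ← phase_add, sub_add_cancel, one_mul]
  rw [this, norm_mul, norm_phase, mul_one]
  exact norm_phase_sub_one_le _

theorem measurable_phase : Measurable phase := by
  unfold phase
  fun_prop

theorem norm_phase_sub_taylor_le {x : ℝ} (hx : |x| ≤ 1) :
    ‖phase x - (1 + Complex.I * x - (x : ℂ) ^ 2 / 2)‖ ≤ |x| ^ 3 := by
  have hn : ‖Complex.I * (x : ℂ)‖ = |x| := by simp
  have h := Complex.exp_bound (x := Complex.I * x) (by rwa [hn]) (n := 3) (by norm_num)
  have e : ∑ k ∈ Finset.range 3, (Complex.I * (x : ℂ)) ^ k / (k.factorial : ℂ)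
      = 1 + Complex.I * x - (x : ℂ) ^ 2 / 2 := by
    simp only [Finset.sum_range_succ, Finset.sum_range_zero, Nat.factorial, mul_pow,
      Complex.I_sq]
    norm_num
    ring
  rw [e, hn] at h
  refine h.trans (mul_le_of_le_one_right (by positivity) ?_)
  norm_num [Nat.factorial]

namespace IsContractingTower

variable {Y : ℕ → Type*} [∀ j, MeasurableSpace (Y j)] {Ω : Type*}
  [MeasurableSpace Ω] {μ : Measure Ω} [IsProbabilityMeasure μ] {η : (j : ℕ) → Ω → Y j}
  {T : (j : ℕ) → Y j → Y (j + 1)} {Q : (j : ℕ) → Y (j + 1) → Measure (Y j)}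
  {ρ : (j : ℕ) → Y j → Y j → ℝ} {θ C : ℝ}

/-- The energy inequality for one step of the twisted averaging operator. -/
theorem norm_integral_twist_le (h : IsContractingTower μ η T Q ρ θ C)
    {m : (j : ℕ) → Y j → ℝ} {K : ℝ} (hm : IsRegularFamily ρ m K) (hQ : IsReverseMartingale Q m)
    {s : ℝ} (hs : |s| * K ≤ 1 / 16) (j : ℕ) {g : Y j → ℂ} (hg : Measurable g) {B : ℝ}
    (hB : ∀ y, ‖g y‖ ≤ B) {g' : Y (j + 1) → ℂ}
    (hg' : ∀ x, g' x = ∫ y, phase (s * m j y) * g y ∂Q j x) {α' : ℂ}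
    (hα' : ∫ w, g' (η (j + 1) w) ∂μ = α') (hcone : ∀ x, ‖g' x - α'‖ ≤ ‖α'‖ / 4) :
    ∫ w, ‖g' (η (j + 1) w)‖ ^ 2 ∂μ ≤ ∫ w, ‖g (η j w)‖ ^ 2 ∂μ ∧
    ‖∫ w, g (η j w) ∂μ‖ * ‖α'‖ + ‖α'‖ ^ 2 * (s ^ 2 * ∫ w, m j (η j w) ^ 2 ∂μ) / 8
      ≤ ‖α'‖ ^ 2 + 2 * (∫ w, ‖g (η j w)‖ ^ 2 ∂μ - ∫ w, ‖g' (η (j + 1) w)‖ ^ 2 ∂μ) := by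
  have hph : ∀ t : ℝ, Measurable fun y => phase (t * m j y) := fun t =>
    measurable_phase.comp ((hm.measurable _).const_mul t)
  have hpg : Measurable fun y => phase (s * m j y) * g y := (hph s).mul hg
  have hpgB : ∀ y, ‖phase (s * m j y) * g y‖ ≤ B := fun y => by
    rw [norm_mul, norm_phase, one_mul]; exact hB y
  have hg'm : Measurable g' := by
    rw [funext hg']; exact h.measurable_average j _ hpg
  have hg'B : ∀ x, ‖g' x‖ ≤ B := fun x => by rw [hg']; exact h.norm_average_le x hpgB
  have hmC : Measurable fun y => (m j y : ℂ) := Complex.measurable_ofReal.comp (hm.measurable j)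
  set M : Ω → ℝ := fun w => m j (η j w) with hM
  set G : Ω → ℂ := fun w => g (η j w) with hG
  set G' : Ω → ℂ := fun w => g' (η (j + 1) w) with hG'
  -- `G'` is the conditional expectation of the twisted function given the next level, and `E` is
  -- the fluctuation around it: it has mean zero and is orthogonal to `G'`.
  set E : Ω → ℂ := fun w => phase (s * M w) * G w - G' w with hE
  have hMi : Integrable M μ := h.integrable_proc (hm.measurable j) (hm.bound j)
  have hMb : ∀ w, ‖M w‖ ≤ K := fun w => hm.bound j _
  have hM2i : Integrable (fun w => M w ^ 2) μ := by
    simp only [sq]; exact hMi.mul_bdd hMi.aestronglyMeasurable (ae_of_all _ hMb)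
  have hGi : Integrable G μ := h.integrable_proc hg hB
  have hG'i : Integrable G' μ := h.integrable_proc hg'm hg'B
  have hpGi : Integrable (fun w => phase (s * M w) * G w) μ := h.integrable_proc hpg hpgB
  have hEi : Integrable E μ := hpGi.sub hG'i
  have hsqi : ∀ {F : Ω → ℂ} {b : ℝ}, Integrable F μ → (∀ w, ‖F w‖ ≤ b) →
      Integrable (fun w => ‖F w‖ ^ 2) μ := fun {F b} hF hb => by
    simp only [sq]
    exact hF.norm.mul_bdd hF.norm.aestronglyMeasurable
      (ae_of_all _ fun w => by rw [norm_norm]; exact hb w)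
  have hEB : ∀ w, ‖E w‖ ≤ B + B := fun w =>
    (norm_sub_le _ _).trans (add_le_add (hpgB _) (hg'B _))
  have hE2i := hsqi hEi hEB
  have hG2i := hsqi hGi (fun w => hB _)
  have hG'2i := hsqi hG'i (fun w => hg'B _)
  have hMG'i : Integrable (fun w => (M w : ℂ) * G' w) μ :=
    hMi.ofReal.mul_bdd hG'i.aestronglyMeasurable (ae_of_all _ fun w => hg'B _)
  -- The first-order term of the expansion vanishes by the martingale property. This is why the
  -- expansion is made around `G'`, which lives on the next level, and not around `G`.
  have hMG' : ∫ w, (M w : ℂ) * G' w ∂μ = 0 := by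
    have h1 := h.integral_mul_shift (j := j) (g := fun y => (m j y : ℂ)) (φ := g') hmC (B := K)
      (fun y => by rw [Complex.norm_real]; exact hm.bound j y) hg'm hg'B
    have e0 : ∀ x, ∫ y, m j y ∂Q j x = 0 := hQ j
    simp only [integral_complex_ofReal, e0, Complex.ofReal_zero, zero_mul, integral_zero] at h1
    exact h1
  have hE0 : ∫ w, E w ∂μ = 0 := by
    have h1 := h.disintegration j _ B hpg hpgB
    simp only [← hg'] at h1
    rw [hE, integral_sub hpGi hG'i, sub_eq_zero]
    exact h1
  have hcross : ∫ w, (phase (s * M w) * G w * starRingEnd ℂ (G' w)).re ∂μ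
      = ∫ w, ‖G' w‖ ^ 2 ∂μ := by
    have hcm : Measurable fun x => starRingEnd ℂ (g' x) :=
      Complex.continuous_conj.measurable.comp hg'm
    have hcB : ∀ x, ‖starRingEnd ℂ (g' x)‖ ≤ B := fun x => by rw [RCLike.norm_conj]; exact hg'B x
    have h1 := h.integral_mul_shift hpg hpgB hcm hcB
    simp only [← hg'] at h1
    have hi1 : Integrable (fun w => phase (s * M w) * G w * starRingEnd ℂ (G' w)) μ :=
      hpGi.mul_bdd (hcm.comp (h.measurable_proc _)).aestronglyMeasurable
        (ae_of_all _ fun w => hcB _)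
    have hi2 : Integrable (fun w => G' w * starRingEnd ℂ (G' w)) μ :=
      hG'i.mul_bdd (hcm.comp (h.measurable_proc _)).aestronglyMeasurable
        (ae_of_all _ fun w => hcB _)
    have h2 := congrArg Complex.re h1
    have e1 := Complex.reCLM.integral_comp_comm hi1
    have e2 := Complex.reCLM.integral_comp_comm hi2
    simp only [Complex.reCLM_apply] at e1 e2
    rw [e1]
    refine h2.trans (e2.symm.trans (integral_congr_ae (ae_of_all _ fun w => ?_)))
    simp only [Complex.mul_conj, Complex.ofReal_re, Complex.sq_norm]
  have hcrossi : Integrable (fun w => (phase (s * M w) * G w * starRingEnd ℂ (G' w)).re) μ :=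
    (hpGi.mul_bdd (c := B) ((Complex.continuous_conj.measurable.comp hg'm).comp
      (h.measurable_proc (j + 1))).aestronglyMeasurable
      (ae_of_all _ fun w => by
        simp only [Function.comp_apply, RCLike.norm_conj]; exact hg'B _)).re
  -- Pythagoras: the energy lost in one step is exactly that of the fluctuation.
  have hloss : ∫ w, ‖E w‖ ^ 2 ∂μ = ∫ w, ‖G w‖ ^ 2 ∂μ - ∫ w, ‖G' w‖ ^ 2 ∂μ := by
    have e : ∀ w, ‖E w‖ ^ 2 = ‖G w‖ ^ 2 + ‖G' w‖ ^ 2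
        - 2 * (phase (s * M w) * G w * starRingEnd ℂ (G' w)).re := fun w => by
      have h1 : ‖G w‖ ^ 2 = ‖phase (s * M w) * G w‖ ^ 2 := by rw [norm_mul, norm_phase, one_mul]
      rw [h1]
      simp only [hE, Complex.sq_norm, Complex.normSq_sub]
    simp only [e]
    have e1 := integral_sub (hG2i.add hG'2i) (hcrossi.const_mul 2)
    have e2 := integral_add hG2i hG'2i
    simp only [Pi.add_apply] at e1
    rw [e1, e2, integral_const_mul, hcross]
    ring
  have hl0 : 0 ≤ ∫ w, ‖E w‖ ^ 2 ∂μ := integral_nonneg fun w => sq_nonneg _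
  refine ⟨by linarith, ?_⟩
  set A' := ‖α'‖ with hA'
  have hA'0 : 0 ≤ A' := norm_nonneg _
  set q := ∫ w, M w ^ 2 ∂μ with hq
  -- Expand `G = phase (-x) * (E + G')` with `x = s * M` to second order. `R` is the remainder after
  -- removing `G'`, the linear term, the quadratic term with `G'` frozen at its mean `α'`, and `E`.
  set R : Ω → ℂ := fun w =>
    G w - (G' w - α' * ((s ^ 2 * M w ^ 2 / 2 : ℝ) : ℂ)) + Complex.I * s * (M w * G' w) - E w with hR
  -- `21 / 64` is `1 / 8` (cone condition in the quadratic term) plus `5 / 64` (cubic Taylor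
  -- remainder) plus `1 / 8` (Young's inequality for the product with `E`). Subtracted from the gain
  -- `1 / 2` it leaves more than the `1 / 8` claimed.
  have hpt : ∀ w, A' * ‖R w‖ ≤ A' ^ 2 * (s ^ 2 * M w ^ 2) * (21 / 64) + 2 * ‖E w‖ ^ 2 := by
    intro w
    set x : ℝ := s * M w with hx
    have hxb : |x| ≤ 1 / 16 := by
      rw [hx, abs_mul]
      exact (mul_le_mul_of_nonneg_left (hMb w) (abs_nonneg s)).trans hs
    set r : ℂ := phase (-x) - (1 + Complex.I * ((-x : ℝ) : ℂ) - ((-x : ℝ) : ℂ) ^ 2 / 2) with hr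
    have hrb : ‖r‖ ≤ x ^ 2 / 16 := by
      have h1 := norm_phase_sub_taylor_le (x := -x) (by rw [abs_neg]; linarith)
      rw [abs_neg] at h1
      have h2 : |x| ^ 3 = x ^ 2 * |x| := by rw [← sq_abs]; ring
      rw [h2] at h1
      have h3 := mul_le_mul_of_nonneg_left hxb (sq_nonneg x)
      refine h1.trans (h3.trans (le_of_eq (by ring)))
    have hp : phase (-x) * (E w + G' w) = G w := by
      simp only [hE, sub_add_cancel, ← mul_assoc, phase_neg_mul_phase, one_mul, ← hx]
    have hRe : R w = -(x ^ 2 / 2 : ℝ) * (G' w - α') + r * G' w + (phase (-x) - 1) * E w := by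
      have hx2 : s ^ 2 * M w ^ 2 / 2 = x ^ 2 / 2 := by rw [hx]; ring
      have hx1 : Complex.I * s * (M w * G' w) = Complex.I * x * G' w := by
        rw [hx]; push_cast; ring
      simp only [hR, hr, hx2, hx1]
      rw [← hp]
      push_cast
      ring
    have hc1 : ‖G' w - α'‖ ≤ A' / 4 := hcone _
    have hc2 : ‖G' w‖ ≤ 5 / 4 * A' := by
      calc ‖G' w‖ = ‖(G' w - α') + α'‖ := by rw [sub_add_cancel]
        _ ≤ _ := norm_add_le _ _
        _ ≤ _ := by rw [← hA']; linarith
    have hc3 : ‖phase (-x) - 1‖ ≤ |x| := by simpa using norm_phase_sub_one_le (-x)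
    have hRb : ‖R w‖ ≤ x ^ 2 / 2 * (A' / 4) + x ^ 2 / 16 * (5 / 4 * A') + |x| * ‖E w‖ := by
      rw [hRe]
      refine (norm_add_le _ _).trans (add_le_add ((norm_add_le _ _).trans (add_le_add ?_ ?_)) ?_)
      · rw [norm_mul, norm_neg, Complex.norm_real, Real.norm_of_nonneg (by positivity)]
        gcongr
      · rw [norm_mul]; gcongr
      · rw [norm_mul]; gcongr
    have hx3 : s ^ 2 * M w ^ 2 = x ^ 2 := by rw [hx]; ring
    rw [hx3]
    have h1 := mul_le_mul_of_nonneg_left hRb hA'0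
    have h2 : A' * (|x| * ‖E w‖) ≤ A' ^ 2 * x ^ 2 / 8 + 2 * ‖E w‖ ^ 2 := by
      have h3 := sq_nonneg (A' * |x| - 4 * ‖E w‖)
      have h4 : (A' * |x|) ^ 2 = A' ^ 2 * x ^ 2 := by rw [mul_pow, sq_abs]
      nlinarith
    nlinarith
  have hquad : Integrable (fun w => α' * ((s ^ 2 * M w ^ 2 / 2 : ℝ) : ℂ)) μ :=
    ((hM2i.const_mul (s ^ 2)).div_const 2).ofReal.const_mul α'
  have hconst : Integrable (fun w => G' w - α' * ((s ^ 2 * M w ^ 2 / 2 : ℝ) : ℂ)) μ :=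
    hG'i.sub hquad
  have hRi : Integrable R μ := ((hGi.sub hconst).add (hMG'i.const_mul _)).sub hEi
  have hRint : ∫ w, R w ∂μ = ∫ w, G w ∂μ - α' * (1 - ((s ^ 2 * q / 2 : ℝ) : ℂ)) := by
    have e1 := integral_sub ((hGi.sub hconst).add (hMG'i.const_mul (Complex.I * s))) hEi
    have e2 := integral_add (hGi.sub hconst) (hMG'i.const_mul (Complex.I * s))
    have e3 := integral_sub hGi hconst
    have e4 : ∫ w, (G' w - α' * ((s ^ 2 * M w ^ 2 / 2 : ℝ) : ℂ)) ∂μ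
        = α' * (1 - ((s ^ 2 * q / 2 : ℝ) : ℂ)) := by
      rw [integral_sub hG'i hquad, integral_const_mul, integral_complex_ofReal, integral_div,
        integral_const_mul, hα', hq]
      ring
    rw [integral_const_mul, hMG', mul_zero, add_zero] at e2
    simp only [Pi.sub_apply, Pi.add_apply] at e1 e2 e3
    rw [hR, e1, e2, e3, e4, hE0, sub_zero]
  have hq0 : 0 ≤ q := integral_nonneg fun w => sq_nonneg _
  have hq1 : s ^ 2 * q ≤ 1 := by
    have h1 : ∀ w, s ^ 2 * M w ^ 2 ≤ 1 := fun w => by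
      have h2 : |s * M w| ≤ 1 := by
        rw [abs_mul]
        refine (mul_le_mul_of_nonneg_left (hMb w) (abs_nonneg s)).trans (hs.trans (by norm_num))
      rw [← mul_pow, sq_le_one_iff_abs_le_one]; exact h2
    rw [hq, ← integral_const_mul]
    have := integral_mono (hM2i.const_mul (s ^ 2)) (integrable_const (1 : ℝ)) h1
    simpa using this
  have hRn : A' * ‖∫ w, R w ∂μ‖ ≤ A' ^ 2 * (s ^ 2 * q) * (21 / 64)
      + 2 * ∫ w, ‖E w‖ ^ 2 ∂μ := by
    have hi1 : Integrable (fun w => A' ^ 2 * (s ^ 2 * M w ^ 2) * (21 / 64)) μ :=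
      ((hM2i.const_mul _).const_mul _).mul_const _
    calc A' * ‖∫ w, R w ∂μ‖ ≤ A' * ∫ w, ‖R w‖ ∂μ := by
          gcongr; exact norm_integral_le_integral_norm _
      _ = ∫ w, A' * ‖R w‖ ∂μ := (integral_const_mul _ _).symm
      _ ≤ ∫ w, (A' ^ 2 * (s ^ 2 * M w ^ 2) * (21 / 64) + 2 * ‖E w‖ ^ 2) ∂μ :=
          integral_mono (hRi.norm.const_mul _) (hi1.add (hE2i.const_mul 2)) hpt
      _ = _ := by
          rw [integral_add hi1 (hE2i.const_mul 2), integral_mul_const, integral_const_mul,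
            integral_const_mul, integral_const_mul]
  have hα : ‖∫ w, G w ∂μ‖ ≤ A' * (1 - s ^ 2 * q / 2) + ‖∫ w, R w ∂μ‖ := by
    have e : ∫ w, G w ∂μ = α' * ((1 - s ^ 2 * q / 2 : ℝ) : ℂ) + ∫ w, R w ∂μ := by
      rw [hRint]; push_cast; ring
    calc ‖∫ w, G w ∂μ‖ ≤ ‖α' * ((1 - s ^ 2 * q / 2 : ℝ) : ℂ)‖ + ‖∫ w, R w ∂μ‖ := by
          conv_lhs => rw [e]
          exact norm_add_le _ _
      _ = _ := by
          rw [norm_mul, Complex.norm_real, Real.norm_of_nonneg (by linarith)]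
  have h1 := mul_le_mul_of_nonneg_left hα hA'0
  have h2 : 0 ≤ A' ^ 2 * (s ^ 2 * q) := by positivity
  rw [← hloss]
  nlinarith

/-- Iteration of the twisted averaging operators `g ↦ ∫ exp(i s m) g dQ`, started at level `J`. -/
def twist (Q : (j : ℕ) → Y (j + 1) → Measure (Y j)) (m : (j : ℕ) → Y j → ℝ) (s : ℝ) (J : ℕ)
    (g : Y J → ℂ) : (n : ℕ) → Y (J + n) → ℂ
  | 0 => g
  | n + 1 => fun x => ∫ y, phase (s * m (J + n) y) * twist Q m s J g n y ∂Q (J + n) x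

theorem measurable_twist (h : IsContractingTower μ η T Q ρ θ C)
    {m : (j : ℕ) → Y j → ℝ} {K : ℝ} (hm : IsRegularFamily ρ m K) (s : ℝ) (J : ℕ)
    {g : Y J → ℂ} (hg : Measurable g) (n : ℕ) : Measurable (twist Q m s J g n) := by
  induction n with
  | zero => exact hg
  | succ n ih =>
    exact h.measurable_average _ _
      ((measurable_phase.comp ((hm.measurable _).const_mul s)).mul ih)

theorem norm_twist_le (h : IsContractingTower μ η T Q ρ θ C)
    {m : (j : ℕ) → Y j → ℝ} (s : ℝ) (J : ℕ) {g : Y J → ℂ} {B : ℝ} (hB : ∀ y, ‖g y‖ ≤ B) (n : ℕ)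
    (x : Y (J + n)) : ‖twist Q m s J g n x‖ ≤ B := by
  induction n with
  | zero => exact hB x
  | succ n ih =>
    exact h.norm_average_le x fun y => by rw [norm_mul, norm_phase, one_mul]; exact ih y

/-- The twisted operators compute the characteristic functions of the partial sums. -/
theorem integral_phase_sum (h : IsContractingTower μ η T Q ρ θ C)
    {m : (j : ℕ) → Y j → ℝ} {K : ℝ} (hm : IsRegularFamily ρ m K) (s : ℝ) (J : ℕ)
    {g : Y J → ℂ} (hg : Measurable g) {B : ℝ} (hB : ∀ y, ‖g y‖ ≤ B) (n : ℕ)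
    {φ : Y (J + n) → ℂ} (hφ : Measurable φ) {B' : ℝ} (hB' : ∀ y, ‖φ y‖ ≤ B') :
    ∫ w, phase (s * ∑ i ∈ Finset.range n, m (J + i) (η (J + i) w)) * g (η J w)
        * φ (η (J + n) w) ∂μ
      = ∫ w, twist Q m s J g n (η (J + n) w) * φ (η (J + n) w) ∂μ := by
  induction n with
  | zero => simp [twist, phase_zero]
  | succ n ih =>
    have hph : Measurable fun y => phase (s * m (J + n) y) :=
      measurable_phase.comp ((hm.measurable _).const_mul s)
    have h1 := ih (φ := fun y => phase (s * m (J + n) y) * φ (T (J + n) y))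
      (hph.mul (hφ.comp (h.measurable_shift _)))
      (fun y => by rw [norm_mul, norm_phase, one_mul]; exact hB' _)
    have h2 := h.integral_mul_shift (j := J + n)
      (g := fun y => phase (s * m (J + n) y) * twist Q m s J g n y)
      (hph.mul (h.measurable_twist hm s J hg n)) (B := B)
      (fun y => by rw [norm_mul, norm_phase, one_mul]; exact h.norm_twist_le s J hB n y) hφ hB'
    simp only [h.shift_proc] at h1
    refine Eq.trans ?_ (h1.trans (Eq.trans ?_ h2))
    · refine integral_congr_ae (ae_of_all _ fun w => ?_)
      simp only [Finset.sum_range_succ, mul_add, phase_add]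
      change _ * φ (η (J + n + 1) w) = _
      ring
    · refine integral_congr_ae (ae_of_all _ fun w => ?_)
      simp only
      ring

/-- The Lipschitz bounds obtained by iterating the twisted averaging operators. -/
def twistBound (θ τ : ℝ) (A : ℕ → ℝ) (N : ℝ) : ℕ → ℝ
  | 0 => N
  | n + 1 => θ * ((1 + τ) * twistBound θ τ A N n + τ * A n)

theorem twistBound_nonneg {θ τ : ℝ} {A : ℕ → ℝ} {N : ℝ} (hθ : 0 ≤ θ) (hτ : 0 ≤ τ)
    (hA : ∀ n, 0 ≤ A n) (hN : 0 ≤ N) (n : ℕ) : 0 ≤ twistBound θ τ A N n := by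
  induction n with
  | zero => exact hN
  | succ n ih =>
    have := hA n
    rw [twistBound]; positivity

theorem norm_phase_mul_sub_le {x y : ℝ} {z z' : ℂ} :
    ‖phase x * z - phase y * z'‖ ≤ ‖z - z'‖ + |x - y| * ‖z'‖ := by
  have e : phase x * z - phase y * z' = phase x * (z - z') + (phase x - phase y) * z' := by ring
  rw [e]
  refine (norm_add_le _ _).trans ?_
  rw [norm_mul, norm_mul, norm_phase, one_mul]
  gcongr
  exact norm_phase_sub_phase_le x y

/-- The product rule needs the sup norm of the iterate, which is at most its mean plus its Lipschitz
bound. This is how the means enter the recursion for `twistBound`. -/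
theorem twist_lip (h : IsContractingTower μ η T Q ρ θ C)
    {m : (j : ℕ) → Y j → ℝ} {K : ℝ} (hK : 0 ≤ K) (hm : IsRegularFamily ρ m K) (s : ℝ) (J : ℕ)
    {g : Y J → ℂ} (hg : Measurable g) {N : ℝ} (hN : 0 ≤ N)
    (hL : ∀ x y, ‖g x - g y‖ ≤ N * ρ J x y) (n : ℕ) (x y : Y (J + n)) :
    ‖twist Q m s J g n x - twist Q m s J g n y‖ ≤
      twistBound θ (|s| * K) (fun n => ‖∫ w, twist Q m s J g n (η (J + n) w) ∂μ‖) N n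
        * ρ (J + n) x y := by
  set A : ℕ → ℝ := fun n => ‖∫ w, twist Q m s J g n (η (J + n) w) ∂μ‖
  have hτ : 0 ≤ |s| * K := by positivity
  have hV := twistBound_nonneg (A := A) h.rate_nonneg hτ (fun n => norm_nonneg _) hN
  induction n with
  | zero => exact hL x y
  | succ n ih =>
    have hmeas := h.measurable_twist hm s J hg n
    have hsup : ∀ y, ‖twist Q m s J g n y‖ ≤ A n + twistBound θ (|s| * K) A N n := fun y => by
      have h1 := h.norm_sub_integral_le hmeas (hV n) ih y
      calc ‖twist Q m s J g n y‖ = ‖(twist Q m s J g n y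
            - ∫ w, twist Q m s J g n (η (J + n) w) ∂μ)
            + ∫ w, twist Q m s J g n (η (J + n) w) ∂μ‖ := by rw [sub_add_cancel]
        _ ≤ _ := norm_add_le _ _
        _ ≤ _ := by rw [add_comm]; exact add_le_add le_rfl h1
    have hA0 : 0 ≤ A n := norm_nonneg _
    have := h.contract (J + n) (fun y => phase (s * m (J + n) y) * twist Q m s J g n y)
      ((1 + |s| * K) * twistBound θ (|s| * K) A N n + |s| * K * A n)
      ((measurable_phase.comp ((hm.measurable _).const_mul s)).mul hmeas)
      (by have := hV n; positivity) (fun x y => by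
        have h1 := ih x y
        have h2 : |s * m (J + n) x - s * m (J + n) y| ≤ |s| * (K * ρ (J + n) x y) := by
          rw [← mul_sub, abs_mul]; gcongr; exact hm.lip _ x y
        have h3 := hsup y
        have h4 := h.gauge_nonneg (J + n) x y
        calc _ ≤ _ := norm_phase_mul_sub_le
          _ ≤ twistBound θ (|s| * K) A N n * ρ (J + n) x y + |s| * (K * ρ (J + n) x y)
            * (A n + twistBound θ (|s| * K) A N n) := by gcongr
          _ = _ := by ring) x y
    exact this

theorem norm_twist_sub_integral_le (h : IsContractingTower μ η T Q ρ θ C)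
    {m : (j : ℕ) → Y j → ℝ} {K : ℝ} (hK : 0 ≤ K) (hm : IsRegularFamily ρ m K) (s : ℝ) (J : ℕ)
    {g : Y J → ℂ} (hg : Measurable g) {N : ℝ} (hN : 0 ≤ N)
    (hL : ∀ x y, ‖g x - g y‖ ≤ N * ρ J x y) (n : ℕ) (x : Y (J + n)) :
    ‖twist Q m s J g n x - ∫ w, twist Q m s J g n (η (J + n) w) ∂μ‖ ≤
      twistBound θ (|s| * K) (fun n => ‖∫ w, twist Q m s J g n (η (J + n) w) ∂μ‖) N n :=
  h.norm_sub_integral_le (h.measurable_twist hm s J hg n)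
    (twistBound_nonneg h.rate_nonneg (by positivity) (fun n => norm_nonneg _) hN n)
    (h.twist_lip hK hm s J hg hN hL n) x

/-- If at some small frequency the characteristic functions of the partial sums of a regular
reverse martingale do not decay, then the martingale is bounded in `L²`. -/
theorem exists_sum_integral_sq_le (h : IsContractingTower μ η T Q ρ θ C)
    {m : (j : ℕ) → Y j → ℝ} {K : ℝ} (hK : 0 ≤ K) (hm : IsRegularFamily ρ m K)
    (hQ : IsReverseMartingale Q m) {s : ℝ} (hs0 : s ≠ 0) (hs : |s| * K ≤ (1 - θ) / 16) (J : ℕ)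
    {g : Y J → ℂ} (hg : Measurable g) {B : ℝ} (hB : ∀ y, ‖g y‖ ≤ B) {N : ℝ} (hN : 0 ≤ N)
    (hL : ∀ x y, ‖g x - g y‖ ≤ N * ρ J x y) {κ : ℝ} (hκ : 0 < κ)
    (hlow : ∀ n, ∃ φ : Y (J + n) → ℂ, Measurable φ ∧ (∀ y, ‖φ y‖ ≤ 1) ∧
      κ ≤ ‖∫ w, phase (s * ∑ i ∈ Finset.range n, m (J + i) (η (J + i) w)) * g (η J w)
        * φ (η (J + n) w) ∂μ‖) :
    ∃ D, ∀ n, ∑ i ∈ Finset.range n, ∫ w, m i (η i w) ^ 2 ∂μ ≤ D := by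
  set G := twist Q m s J g with hG
  set τ := |s| * K with hτdef
  have hτ : 0 ≤ τ := by positivity
  set α : ℕ → ℂ := fun n => ∫ w, G n (η (J + n) w) ∂μ with hα
  set A : ℕ → ℝ := fun n => ‖α n‖ with hA
  set V := twistBound θ τ A N with hVdef
  have hθ1 := h.rate_lt_one
  have hθ0 := h.rate_nonneg
  have hV : ∀ n, 0 ≤ V n := twistBound_nonneg hθ0 hτ (fun n => norm_nonneg _) hN
  have hGm : ∀ n, Measurable (G n) := h.measurable_twist hm s J hg
  have hGB : ∀ n x, ‖G n x‖ ≤ B := fun n x => h.norm_twist_le s J hB n x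
  have hGα : ∀ n x, ‖G n x - α n‖ ≤ V n := h.norm_twist_sub_integral_le hK hm s J hg hN hL
  have hGV : ∀ n x, ‖G n x‖ ≤ A n + V n := fun n x => by
    calc ‖G n x‖ = ‖(G n x - α n) + α n‖ := by rw [sub_add_cancel]
      _ ≤ _ := norm_add_le _ _
      _ ≤ _ := by rw [add_comm]; exact add_le_add le_rfl (hGα n x)
  have hGi : ∀ n, Integrable (fun w => G n (η (J + n) w)) μ := fun n =>
    h.integrable_proc (hGm n) (hGB n)
  -- The final factor has modulus at most one, so a lower bound on the twisted integral is a lower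
  -- bound on the sup norm of the iterate.
  have hlow' : ∀ n, κ ≤ A n + V n := fun n => by
    obtain ⟨φ, hφm, hφ1, hφ⟩ := hlow n
    rw [h.integral_phase_sum hm s J hg hB n hφm hφ1] at hφ
    refine hφ.trans ?_
    have := norm_integral_le_of_norm_le_const (μ := μ) (C := A n + V n)
      (f := fun w => G n (η (J + n) w) * φ (η (J + n) w)) (ae_of_all _ fun w => by
        rw [norm_mul]
        exact (mul_le_of_le_one_right (norm_nonneg _) (hφ1 _)).trans (hGV n _))
    simpa using this
  have hαsucc : ∀ n, α (n + 1)
      = ∫ w, phase (s * m (J + n) (η (J + n) w)) * G n (η (J + n) w) ∂μ := fun n =>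
    (h.disintegration (J + n) (fun y => phase (s * m (J + n) y) * G n y) B
      ((measurable_phase.comp ((hm.measurable _).const_mul s)).mul (hGm n))
      (fun y => by rw [norm_mul, norm_phase, one_mul]; exact hGB n y)).symm
  have hAstep : ∀ n, A n - τ * (A n + V n) ≤ A (n + 1) := fun n => by
    have hpi : Integrable (fun w => phase (s * m (J + n) (η (J + n) w)) * G n (η (J + n) w)) μ :=
      h.integrable_proc (g := fun y => phase (s * m (J + n) y) * G n y)
        ((measurable_phase.comp ((hm.measurable _).const_mul s)).mul (hGm n)) (B := B)
        (fun y => by rw [norm_mul, norm_phase, one_mul]; exact hGB n y)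
    have hd : ‖α (n + 1) - α n‖ ≤ τ * (A n + V n) := by
      rw [hαsucc, hα, ← integral_sub hpi (hGi n)]
      have := norm_integral_le_of_norm_le_const (μ := μ) (C := τ * (A n + V n))
        (f := fun w => phase (s * m (J + n) (η (J + n) w)) * G n (η (J + n) w)
          - G n (η (J + n) w)) (ae_of_all _ fun w => by
          rw [← sub_one_mul, norm_mul]
          refine mul_le_mul ((norm_phase_sub_one_le _).trans ?_) (hGV n _) (norm_nonneg _) hτ
          rw [abs_mul]
          exact mul_le_mul_of_nonneg_left (hm.bound _ _) (abs_nonneg s))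
      simpa using this
    have := norm_sub_norm_le (α n) (α (n + 1))
    rw [norm_sub_rev] at this
    simp only [hA]
    linarith
  obtain ⟨n₁, hn₁⟩ := eventually_le_of_contraction (fun n => norm_nonneg (α n)) hV hθ0 hθ1 hτ hs
    (fun n => le_rfl) hAstep hκ hlow'
  have hAlow : ∀ n ≥ n₁, κ / 2 ≤ A n := fun n hn => by
    have := hn₁ n hn
    have := hlow' n
    simp only [hA] at *
    linarith [norm_nonneg (α n)]
  have hAB : ∀ n, A n ≤ B := fun n => by
    simpa using norm_integral_le_of_norm_le_const (μ := μ) (ae_of_all _ fun w =>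
      hGB n (η (J + n) w))
  set β : ℕ → ℝ := fun n => ∫ w, ‖G n (η (J + n) w)‖ ^ 2 ∂μ with hβ
  set q : ℕ → ℝ := fun n => ∫ w, m n (η n w) ^ 2 ∂μ with hq
  have hq0 : ∀ n, 0 ≤ q n := fun n => integral_nonneg fun w => sq_nonneg _
  have hβ0 : ∀ n, 0 ≤ β n := fun n => integral_nonneg fun w => sq_nonneg _
  -- Divide the energy inequality by `A (n + 1)`, which is at least `κ / 2` inside the cone. Both
  -- terms on the right telescope.
  have hstep : ∀ n ≥ n₁, κ / 2 * (s ^ 2 * q (J + n)) / 8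
      ≤ (A (n + 1) - A n) + 4 / κ * (β n - β (n + 1)) := fun n hn => by
    obtain ⟨h1, h2⟩ := h.norm_integral_twist_le hm hQ (s := s) (by linarith) (J + n) (hGm n)
      (hGB n) (g' := G (n + 1)) (fun x => rfl) (α' := α (n + 1)) rfl
      (fun x => (hGα (n + 1) x).trans (hn₁ (n + 1) (by omega)))
    have h2' : A n * A (n + 1) + A (n + 1) ^ 2 * (s ^ 2 * q (J + n)) / 8
      ≤ A (n + 1) ^ 2 + 2 * (β n - β (n + 1)) := h2
    have hb := hAlow (n + 1) (by omega)
    have hb0 : 0 < A (n + 1) := by linarith [half_pos hκ]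
    have hl : 0 ≤ β n - β (n + 1) := sub_nonneg.2 h1
    have hsq : 0 ≤ s ^ 2 * q (J + n) := mul_nonneg (sq_nonneg _) (hq0 _)
    have h3 : A (n + 1) * (s ^ 2 * q (J + n)) / 8
        ≤ (A (n + 1) - A n) + 2 * (β n - β (n + 1)) / A (n + 1) := by
      rw [← sub_le_iff_le_add', le_div_iff₀ hb0]
      nlinarith
    have h4 : 2 * (β n - β (n + 1)) / A (n + 1) ≤ 4 / κ * (β n - β (n + 1)) := by
      rw [div_le_iff₀ hb0]
      have : 2 ≤ 4 / κ * A (n + 1) := by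
        rw [div_mul_eq_mul_div, le_div_iff₀ hκ]; linarith
      nlinarith
    have h5 : κ / 2 * (s ^ 2 * q (J + n)) / 8 ≤ A (n + 1) * (s ^ 2 * q (J + n)) / 8 := by
      gcongr
    linarith
  have htel : ∀ k, ∑ i ∈ Finset.range k, κ / 2 * (s ^ 2 * q (J + (n₁ + i))) / 8
      ≤ (A (n₁ + k) - A n₁) + 4 / κ * (β n₁ - β (n₁ + k)) := fun k => by
    induction k with
    | zero => simp
    | succ k ih =>
      rw [Finset.sum_range_succ]
      have := hstep (n₁ + k) (by omega)
      rw [← add_assoc n₁ k 1]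
      linarith
  set c := κ / 2 * s ^ 2 / 8 with hc
  have hc0 : 0 < c := by positivity
  -- The telescoped sum is at most `B + 4 / κ * β n₁`, since `0 ≤ A ≤ B` and `0 ≤ β`; the levels
  -- before `J + n₁` are added separately.
  refine ⟨∑ i ∈ Finset.range (J + n₁), q i + (B + 4 / κ * β n₁) / c, fun n => ?_⟩
  have hsub : ∑ i ∈ Finset.range n, q i ≤ ∑ i ∈ Finset.range (J + n₁ + n), q i :=
    Finset.sum_le_sum_of_subset_of_nonneg (Finset.range_mono (by omega)) fun i _ _ => hq0 i
  refine hsub.trans ?_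
  rw [Finset.sum_range_add]
  gcongr
  rw [le_div_iff₀ hc0, Finset.sum_mul]
  have h1 := htel n
  have h2 : 0 ≤ 4 / κ * β (n₁ + n) := mul_nonneg (by positivity) (hβ0 _)
  have h3 : 0 ≤ A n₁ := norm_nonneg _
  have h4 := hAB (n₁ + n)
  have e : ∑ i ∈ Finset.range n, q (J + n₁ + i) * c
      = ∑ i ∈ Finset.range n, κ / 2 * (s ^ 2 * q (J + (n₁ + i))) / 8 :=
    Finset.sum_congr rfl fun i _ => by rw [add_assoc, hc]; ring
  rw [e]
  linarith

end IsContractingTower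

end MarkovShift

/-! ### Square-integrable boundedness of Birkhoff sums -/

namespace MarkovShift

namespace IsContractingTower

variable {Y : ℕ → Type*} [∀ j, MeasurableSpace (Y j)] {Ω : Type*}
  [MeasurableSpace Ω] {μ : Measure Ω} [IsProbabilityMeasure μ] {η : (j : ℕ) → Ω → Y j}
  {T : (j : ℕ) → Y j → Y (j + 1)} {Q : (j : ℕ) → Y (j + 1) → Measure (Y j)}
  {ρ : (j : ℕ) → Y j → Y j → ℝ} {θ C : ℝ}

theorem integrable_sum_sq (h : IsContractingTower μ η T Q ρ θ C)
    {m : (j : ℕ) → Y j → ℝ} {K : ℝ} (hm : IsRegularFamily ρ m K) (J n : ℕ) :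
    Integrable (fun w => (∑ i ∈ Finset.range n, m (J + i) (η (J + i) w)) ^ 2) μ := by
  simp only [sq]
  exact (h.integrable_sum hm J n).mul_bdd (h.integrable_sum hm J n).aestronglyMeasurable
    (ae_of_all _ fun w => abs_sum_le hm J n w)

theorem sum_eq_sum_martingale_add_zero (h : IsContractingTower μ η T Q ρ θ C)
    {F m u : (j : ℕ) → Y j → ℝ} (hFm : ∀ j x, F j x = m j x + u (j + 1) (T j x) - u j x)
    (hu0 : ∀ x, u 0 x = 0) (n : ℕ) (w : Ω) :
    ∑ i ∈ Finset.range n, F i (η i w) = ∑ i ∈ Finset.range n, m i (η i w) + u n (η n w) := by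
  induction n with
  | zero => simp [hu0]
  | succ n ih =>
    rw [Finset.sum_range_succ, Finset.sum_range_succ, ih, hFm, h.shift_proc]
    ring

theorem integral_sum_sq_zero (h : IsContractingTower μ η T Q ρ θ C)
    {m : (j : ℕ) → Y j → ℝ} {K : ℝ} (hm : IsRegularFamily ρ m K) (hQ : IsReverseMartingale Q m)
    (n : ℕ) :
    ∫ w, (∑ i ∈ Finset.range n, m i (η i w)) ^ 2 ∂μ
      = ∑ i ∈ Finset.range n, ∫ w, m i (η i w) ^ 2 ∂μ := by
  have e : ∀ i, (∀ w, m (0 + i) (η (0 + i) w) = m i (η i w)) := fun i w => by rw [zero_add]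
  have := h.integral_sum_sq hm hQ 0 n
  simpa only [e] using this

theorem integrable_sum_sq_zero (h : IsContractingTower μ η T Q ρ θ C)
    {m : (j : ℕ) → Y j → ℝ} {K : ℝ} (hm : IsRegularFamily ρ m K) (n : ℕ) :
    Integrable (fun w => (∑ i ∈ Finset.range n, m i (η i w)) ^ 2) μ := by
  have e : ∀ i, (∀ w, m (0 + i) (η (0 + i) w) = m i (η i w)) := fun i w => by rw [zero_add]
  have := h.integrable_sum_sq hm 0 n
  simpa only [e] using this

theorem integral_sum_sq_le_of_martingale (h : IsContractingTower μ η T Q ρ θ C)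
    {F m u : (j : ℕ) → Y j → ℝ} {K : ℝ} (hm : IsRegularFamily ρ m K) (hu : IsRegularFamily ρ u K)
    (hQ : IsReverseMartingale Q m) (hu0 : ∀ x, u 0 x = 0)
    (hFm : ∀ j x, F j x = m j x + u (j + 1) (T j x) - u j x) {D : ℝ}
    (hD : ∀ n, ∑ i ∈ Finset.range n, ∫ w, m i (η i w) ^ 2 ∂μ ≤ D) (n : ℕ) :
    ∫ w, (∑ i ∈ Finset.range n, F i (η i w)) ^ 2 ∂μ ≤ 2 * D + 2 * K ^ 2 := by
  have hi := h.integrable_sum_sq_zero hm n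
  have hpt : ∀ w, (∑ i ∈ Finset.range n, F i (η i w)) ^ 2
      ≤ 2 * (∑ i ∈ Finset.range n, m i (η i w)) ^ 2 + 2 * K ^ 2 := fun w => by
    rw [h.sum_eq_sum_martingale_add_zero hFm hu0]
    have h1 : u n (η n w) ^ 2 ≤ K ^ 2 := sq_le_sq' (abs_le.1 (hu.bound _ _)).1
      (abs_le.1 (hu.bound _ _)).2
    nlinarith [sq_nonneg (∑ i ∈ Finset.range n, m i (η i w) - u n (η n w))]
  have hi2 : Integrable (fun w => 2 * (∑ i ∈ Finset.range n, m i (η i w)) ^ 2 + 2 * K ^ 2) μ :=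
    (hi.const_mul 2).add (integrable_const _)
  refine (integral_mono_of_nonneg (ae_of_all _ fun w => sq_nonneg _) hi2
    (ae_of_all _ hpt)).trans ?_
  rw [integral_add (hi.const_mul 2) (integrable_const _), integral_const_mul,
    h.integral_sum_sq_zero hm hQ]
  simpa using hD n

theorem martingale_sum_le (h : IsContractingTower μ η T Q ρ θ C)
    {F m u : (j : ℕ) → Y j → ℝ} {K K' : ℝ} (hF : IsRegularFamily ρ F K')
    (hm : IsRegularFamily ρ m K) (hu : IsRegularFamily ρ u K)
    (hQ : IsReverseMartingale Q m) (hu0 : ∀ x, u 0 x = 0)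
    (hFm : ∀ j x, F j x = m j x + u (j + 1) (T j x) - u j x) (n : ℕ) :
    ∑ i ∈ Finset.range n, ∫ w, m i (η i w) ^ 2 ∂μ
      ≤ 2 * ∫ w, (∑ i ∈ Finset.range n, F i (η i w)) ^ 2 ∂μ + 2 * K ^ 2 := by
  have hi := h.integrable_sum_sq_zero hF n
  have hpt : ∀ w, (∑ i ∈ Finset.range n, m i (η i w)) ^ 2
      ≤ 2 * (∑ i ∈ Finset.range n, F i (η i w)) ^ 2 + 2 * K ^ 2 := fun w => by
    have e := h.sum_eq_sum_martingale_add_zero hFm hu0 n w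
    have h1 : u n (η n w) ^ 2 ≤ K ^ 2 := sq_le_sq' (abs_le.1 (hu.bound _ _)).1
      (abs_le.1 (hu.bound _ _)).2
    have e2 : ∑ i ∈ Finset.range n, m i (η i w)
        = ∑ i ∈ Finset.range n, F i (η i w) - u n (η n w) := by linarith
    rw [e2]
    nlinarith [sq_nonneg (∑ i ∈ Finset.range n, F i (η i w) + u n (η n w))]
  rw [← h.integral_sum_sq_zero hm hQ]
  have hi2 : Integrable (fun w => 2 * (∑ i ∈ Finset.range n, F i (η i w)) ^ 2 + 2 * K ^ 2) μ :=
    (hi.const_mul 2).add (integrable_const _)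
  refine (integral_mono_of_nonneg (ae_of_all _ fun w => sq_nonneg _) hi2
    (ae_of_all _ hpt)).trans ?_
  rw [integral_add (hi.const_mul 2) (integrable_const _), integral_const_mul]
  simp

/-- If the variances of the partial sums do not tend to infinity, they are bounded. -/
theorem exists_integral_sum_sq_le_of_frequently (h : IsContractingTower μ η T Q ρ θ C)
    {F : (j : ℕ) → Y j → ℝ} {K : ℝ} (hK : 0 ≤ K) (hF : IsRegularFamily ρ F K)
    (hF0 : ∀ j, ∫ w, F j (η j w) ∂μ = 0) {B : ℝ}
    (hB : ∃ᶠ n in atTop, ∫ w, (∑ i ∈ Finset.range n, F i (η i w)) ^ 2 ∂μ ≤ B) :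
    ∃ D, ∀ n, ∫ w, (∑ i ∈ Finset.range n, F i (η i w)) ^ 2 ∂μ ≤ D := by
  obtain ⟨m, u, K', hK', hm, hu, hQ, hu0, hFm⟩ := h.exists_martingale_decomposition hK hF hF0
  refine ⟨_, h.integral_sum_sq_le_of_martingale hm hu hQ hu0 hFm (D := 2 * B + 2 * K' ^ 2)
    fun n => ?_⟩
  -- The variance of the martingale part is nondecreasing in `n`, so a bound at some later `N`
  -- suffices.
  obtain ⟨N, hN, hNB⟩ := (Filter.frequently_atTop.1 hB) n
  calc _ ≤ ∑ i ∈ Finset.range N, ∫ w, m i (η i w) ^ 2 ∂μ :=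
        Finset.sum_le_sum_of_subset_of_nonneg (Finset.range_mono hN) fun i _ _ =>
          integral_nonneg fun w => sq_nonneg _
    _ ≤ _ := h.martingale_sum_le hF hm hu hQ hu0 hFm N
    _ ≤ _ := by gcongr

/-- If the partial sums are tight after translation, their variances are bounded. -/
theorem exists_integral_sum_sq_le_of_tight (h : IsContractingTower μ η T Q ρ θ C)
    {F : (j : ℕ) → Y j → ℝ} {K : ℝ} (hK : 0 ≤ K) (hF : IsRegularFamily ρ F K)
    (hF0 : ∀ j, ∫ w, F j (η j w) ∂μ = 0) (c : ℕ → ℝ) {R : ℝ} (hR : 0 ≤ R)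
    (htight : ∀ n, 1 ≤ n →
      μ.real {w | R < |c n + ∑ i ∈ Finset.range n, F i (η i w)|} ≤ 1 / 4) :
    ∃ D, ∀ n, ∫ w, (∑ i ∈ Finset.range n, F i (η i w)) ^ 2 ∂μ ≤ D := by
  obtain ⟨m, u, K', hK', hm, hu, hQ, hu0, hFm⟩ := h.exists_martingale_decomposition hK hF hF0
  have hθ : 0 < 1 - θ := sub_pos.2 h.rate_lt_one
  -- The first entry puts `s` in the range of the small-frequency estimate; the second makes the
  -- phase vary little on `[-R, R]`.
  set s : ℝ := min ((1 - θ) / 16 / (K' + 1)) (1 / (4 * (R + 1))) with hs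
  have hs0 : 0 < s := lt_min (by positivity) (by positivity)
  have hs1 : |s| * K' ≤ (1 - θ) / 16 := by
    rw [abs_of_pos hs0]
    have h1 : s * (K' + 1) ≤ (1 - θ) / 16 := by
      rw [← le_div_iff₀ (by positivity)]; exact min_le_left _ _
    nlinarith
  have hs2 : s * R ≤ 1 / 4 := by
    have h1 : s * (4 * (R + 1)) ≤ 1 := by
      rw [← le_div_iff₀ (by positivity)]; exact min_le_right _ _
    nlinarith
  obtain ⟨D, hD⟩ := h.exists_sum_integral_sq_le hK' hm hQ hs0.ne' hs1 0 (g := fun _ => 1)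
    measurable_const (B := 1) (by simp) (N := 0) le_rfl (by simp) (κ := 1 / 4) (by norm_num)
    (fun n => by
      -- The final factor restores the coboundary, turning the martingale sum into the sum of `F`.
      refine ⟨fun y => phase (s * u (0 + n) y),
        measurable_phase.comp ((hu.measurable _).const_mul s), fun y => (norm_phase _).le, ?_⟩
      set S : Ω → ℝ := fun w => ∑ i ∈ Finset.range n, F i (η i w) with hSdef
      have hSm : Measurable S :=
        Finset.measurable_sum _ fun i _ => (hF.measurable i).comp (h.measurable_proc i)
      have e1 : ∫ w, phase (s * ∑ i ∈ Finset.range n, m (0 + i) (η (0 + i) w)) * 1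
          * phase (s * u (0 + n) (η (0 + n) w)) ∂μ = ∫ w, phase (s * S w) ∂μ := by
        refine integral_congr_ae (ae_of_all _ fun w => ?_)
        have e2 := h.sum_eq_sum_martingale_add hFm 0 n w
        rw [hu0, sub_zero] at e2
        have e3 : ∀ i, F (0 + i) (η (0 + i) w) = F i (η i w) := fun i => by rw [zero_add]
        simp only [mul_one, ← phase_add, ← mul_add, ← e2, hSdef, e3]
      rw [e1]
      rcases Nat.eq_zero_or_pos n with hn | hn
      · have : ∀ w, S w = 0 := fun w => by simp [hSdef, hn]
        simp only [this, mul_zero, phase_zero]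
        norm_num
      · set Z : Ω → ℝ := fun w => c n + S w
        have hZm : Measurable Z := hSm.const_add _
        set A : Set Ω := {w | R < |Z w|}
        have hA : MeasurableSet A := measurableSet_lt measurable_const hZm.abs
        have hAμ : μ.real A ≤ 1 / 4 := htight n hn
        have hpi : Integrable (fun w => phase (s * Z w)) μ :=
          Integrable.of_bound (measurable_phase.comp (hZm.const_mul s)).aestronglyMeasurable 1
            (ae_of_all _ fun w => (norm_phase _).le)
        -- `1 / 4` from the region `|Z| ≤ R`, and `2 * (1 / 4)` from its complement.
        have hd : ‖∫ w, phase (s * Z w) ∂μ - 1‖ ≤ 3 / 4 := by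
          have e3 : ∫ w, phase (s * Z w) ∂μ - 1 = ∫ w, (phase (s * Z w) - 1) ∂μ := by
            rw [integral_sub hpi (integrable_const _)]; simp
          have hbd : ∀ w, ‖phase (s * Z w) - 1‖ ≤ 1 / 4 + A.indicator (fun _ => 2) w := fun w => by
            by_cases hw : w ∈ A
            · simp only [hw, Set.indicator_of_mem]
              refine (norm_sub_le _ _).trans ?_
              rw [norm_phase]; norm_num
            · simp only [hw, not_false_eq_true, Set.indicator_of_notMem, add_zero]
              refine (norm_phase_sub_one_le _).trans ?_
              rw [abs_mul, abs_of_pos hs0]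
              exact (mul_le_mul_of_nonneg_left (not_lt.1 hw) hs0.le).trans hs2
          have hii : Integrable (A.indicator fun _ => (2 : ℝ)) μ :=
            (integrable_const 2).indicator hA
          rw [e3]
          refine (norm_integral_le_of_norm_le ((integrable_const _).add hii)
            (ae_of_all _ hbd)).trans ?_
          have e4 := integral_add (integrable_const (1 / 4 : ℝ)) hii (μ := μ)
          have e5 : ∫ w, A.indicator (fun _ => (2 : ℝ)) w ∂μ = μ.real A * 2 := by
            rw [integral_indicator hA]; simp
          simp only [Pi.add_apply]
          rw [e4, e5]
          simp
          linarith
        have e6 : ∫ w, phase (s * Z w) ∂μ = phase (s * c n) * ∫ w, phase (s * S w) ∂μ := by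
          rw [← integral_const_mul]
          refine integral_congr_ae (ae_of_all _ fun w => ?_)
          simp only [Z, mul_add, phase_add]
        have e7 : ‖∫ w, phase (s * S w) ∂μ‖ = ‖∫ w, phase (s * Z w) ∂μ‖ := by
          rw [e6, norm_mul, norm_phase, one_mul]
        rw [e7]
        have := norm_sub_norm_le (1 : ℂ) (∫ w, phase (s * Z w) ∂μ)
        rw [norm_sub_rev, norm_one] at this
        linarith)
  exact ⟨_, h.integral_sum_sq_le_of_martingale hm hu hQ hu0 hFm hD⟩

/-- If, at some small frequency, a centred regular sequence agrees up to constants with one whose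
partial sums are bounded in `L²`, then its own partial sums are bounded in `L²`. -/
theorem exists_frequency_bound (h : IsContractingTower μ η T Q ρ θ C)
    {F : (j : ℕ) → Y j → ℝ} {K : ℝ} (hK : 0 ≤ K) (hF : IsRegularFamily ρ F K)
    (hF0 : ∀ j, ∫ w, F j (η j w) ∂μ = 0) :
    ∃ t₀ > 0, ∀ t : ℝ, t ≠ 0 → |t| ≤ t₀ → ∀ (F' : (j : ℕ) → Y j → ℝ) (K' : ℝ) (c : ℕ → ℝ),
      0 ≤ K' → IsRegularFamily ρ F' K' → (∀ j, ∫ w, F' j (η j w) ∂μ = 0) →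
      (∃ D, ∀ n, ∫ w, (∑ i ∈ Finset.range n, F' i (η i w)) ^ 2 ∂μ ≤ D) →
      (∀ j x, phase (t * F j x) = phase (t * (F' j x + c j))) →
      ∃ D, ∀ n, ∫ w, (∑ i ∈ Finset.range n, F i (η i w)) ^ 2 ∂μ ≤ D := by
  obtain ⟨m, u, K₁, hK₁, hm, hu, hQ, hu0, hFm⟩ := h.exists_martingale_decomposition hK hF hF0
  have hθ : 0 < 1 - θ := sub_pos.2 h.rate_lt_one
  -- The threshold depends only on the decomposition of `F`, hence is uniform over all `F'`.
  refine ⟨(1 - θ) / 16 / (K₁ + 1), by positivity, ?_⟩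
  rintro t ht0 ht F' K' c hK' hF' hF'0 ⟨D', hD'⟩ hphase
  obtain ⟨m', v, K₂, hK₂, hm', hv, hQ', hv0, hFm'⟩ :=
    h.exists_martingale_decomposition hK' hF' hF'0
  have ht1 : |t| * K₁ ≤ (1 - θ) / 16 := by
    have h1 : |t| * (K₁ + 1) ≤ (1 - θ) / 16 := by
      rw [← le_div_iff₀ (by positivity)]; exact ht
    nlinarith [abs_nonneg t]
  set q : ℕ → ℝ := fun i => ∫ w, m' i (η i w) ^ 2 ∂μ
  have hq0 : ∀ i, 0 ≤ q i := fun i => integral_nonneg fun w => sq_nonneg _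
  have hsum : Summable q := summable_of_sum_range_le hq0 (c := 2 * D' + 2 * K₂ ^ 2) fun n =>
    (h.martingale_sum_le hF' hm' hv hQ' hv0 hFm' n).trans (by gcongr; exact hD' n)
  have htail := tendsto_sum_nat_add q
  -- The martingale part of `F'` has summable variances, so from some level `J` on it contributes at
  -- most `1 / 4` at frequency `t`. The level may depend on `F'` and `t`, since the main estimate
  -- allows any starting level.
  obtain ⟨J, hJ⟩ := (htail.eventually
    (gt_mem_nhds (show (0 : ℝ) < 1 / (4 * t ^ 2) by positivity))).exists
  have hJn : ∀ n, t ^ 2 * ∑ i ∈ Finset.range n, q (J + i) ≤ 1 / 4 := fun n => by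
    have h1 : ∑ i ∈ Finset.range n, q (J + i) ≤ ∑' k, q (k + J) := by
      have := ((summable_nat_add_iff J).2 hsum).sum_le_tsum (Finset.range n) fun i _ => hq0 _
      simpa only [add_comm J] using this
    have h2 : t ^ 2 * (1 / (4 * t ^ 2)) = 1 / 4 := by field_simp
    calc _ ≤ t ^ 2 * (1 / (4 * t ^ 2)) := by gcongr; exact h1.trans hJ.le
      _ = _ := h2
  -- Replacing the martingale part of `F` by that of `F'` leaves the coboundaries of both at the two
  -- ends; `g` is the initial factor, and the final one is the test function supplied below.
  set g : Y J → ℂ := fun y => phase (t * (v J y - u J y))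
  have hgm : Measurable g :=
    measurable_phase.comp (((hv.measurable J).sub (hu.measurable J)).const_mul t)
  have hgL : ∀ x y, ‖g x - g y‖ ≤ |t| * (K₂ + K₁) * ρ J x y := fun x y => by
    refine (norm_phase_sub_phase_le _ _).trans ?_
    rw [← mul_sub, abs_mul, mul_assoc]
    gcongr
    have h1 := hv.lip J x y
    have h2 := hu.lip J x y
    rw [add_mul]
    rw [abs_le] at *
    constructor <;> linarith
  obtain ⟨D, hD⟩ := h.exists_sum_integral_sq_le hK₁ hm hQ ht0 ht1 J hgm (B := 1)
    (fun y => (norm_phase _).le) (N := |t| * (K₂ + K₁)) (by positivity) hgL (κ := 1 / 2)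
    (by norm_num) (fun n => by
      refine ⟨fun y => phase (t * (u (J + n) y - v (J + n) y)),
        measurable_phase.comp (((hu.measurable _).sub (hv.measurable _)).const_mul t),
        fun y => (norm_phase _).le, ?_⟩
      set N' : Ω → ℝ := fun w => ∑ i ∈ Finset.range n, m' (J + i) (η (J + i) w) with hN'
      have hprod : ∀ k w, phase (t * ∑ i ∈ Finset.range k, F (J + i) (η (J + i) w))
          = phase (t * ∑ i ∈ Finset.range k, F' (J + i) (η (J + i) w))
            * phase (t * ∑ i ∈ Finset.range k, c (J + i)) := fun k w => by
        induction k with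
        | zero => simp [phase_zero]
        | succ k ih =>
          simp only [Finset.sum_range_succ]
          rw [mul_add, phase_add, ih, hphase]
          simp only [mul_add, phase_add]
          ring
      have e1 : ∀ w, phase (t * ∑ i ∈ Finset.range n, m (J + i) (η (J + i) w)) * g (η J w)
          * phase (t * (u (J + n) (η (J + n) w) - v (J + n) (η (J + n) w)))
          = phase (t * ∑ i ∈ Finset.range n, c (J + i)) * phase (t * N' w) := fun w => by
        have e2 := h.sum_eq_sum_martingale_add hFm J n w
        have e3 := h.sum_eq_sum_martingale_add hFm' J n w
        have e4 := hprod n w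
        have e5 : t * ∑ i ∈ Finset.range n, m (J + i) (η (J + i) w)
            + t * (v J (η J w) - u J (η J w))
            + t * (u (J + n) (η (J + n) w) - v (J + n) (η (J + n) w))
            = t * ∑ i ∈ Finset.range n, F (J + i) (η (J + i) w)
              + t * (v J (η J w) - v (J + n) (η (J + n) w)) := by rw [e2]; ring
        have e6 : t * N' w = t * ∑ i ∈ Finset.range n, F' (J + i) (η (J + i) w)
            + t * (v J (η J w) - v (J + n) (η (J + n) w)) := by rw [e3, hN']; ring
        simp only [g]
        rw [← phase_add, ← phase_add, e5, phase_add, e4, e6, phase_add]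
        ring
      simp only [e1]
      rw [integral_const_mul, norm_mul, norm_phase, one_mul]
      have hN'm : Measurable N' := h.measurable_sum hm' J n
      have hpi : Integrable (fun w => phase (t * N' w)) μ :=
        Integrable.of_bound (measurable_phase.comp (hN'm.const_mul t)).aestronglyMeasurable 1
          (ae_of_all _ fun w => (norm_phase _).le)
      have hd : ‖∫ w, phase (t * N' w) ∂μ - 1‖ ≤ 1 / 2 := by
        have e3 : ∫ w, phase (t * N' w) ∂μ - 1 = ∫ w, (phase (t * N' w) - 1) ∂μ := by
          rw [integral_sub hpi (integrable_const _)]; simp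
        -- From `|y| ≤ y² + 1 / 4`.
        have hbd : ∀ w, ‖phase (t * N' w) - 1‖ ≤ t ^ 2 * N' w ^ 2 + 1 / 4 := fun w => by
          refine (norm_phase_sub_one_le _).trans ?_
          rw [← mul_pow, ← sq_abs (t * N' w)]
          nlinarith [sq_nonneg (|t * N' w| - 1 / 2)]
        have hii : Integrable (fun w => t ^ 2 * N' w ^ 2) μ :=
          (h.integrable_sum_sq hm' J n).const_mul _
        rw [e3]
        refine (norm_integral_le_of_norm_le (hii.add (integrable_const _))
          (ae_of_all _ hbd)).trans ?_
        have e4 := integral_add hii (integrable_const (1 / 4 : ℝ)) (μ := μ)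
        have e5 := h.integral_sum_sq hm' hQ' J n
        have e6 := hJn n
        simp only [Pi.add_apply]
        rw [e4, integral_const_mul, e5]
        simp
        linarith
      have := norm_sub_norm_le (1 : ℂ) (∫ w, phase (t * N' w) ∂μ)
      rw [norm_sub_rev, norm_one] at this
      linarith)
  exact ⟨_, h.integral_sum_sq_le_of_martingale hm hu hQ hu0 hFm hD⟩

end IsContractingTower

end MarkovShift

/-! ### The tower of path spaces -/

namespace MarkovShift

universe u

variable {X : ℕ → Type u}

/-- Forgetting the first coordinate of a path. -/
def Path.tail {j : ℕ} (x : Path X j) : Path X (j + 1) :=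
  fun k => x ⟨k, (Nat.le_succ j).trans k.2⟩

/-- The first coordinate of a path. -/
abbrev Path.head {j : ℕ} (x : Path X j) : X j := x ⟨j, Set.self_mem_Ici⟩

/-- Prepending a state to a path. -/
def Path.cons {j : ℕ} (y : X j) (x : Path X (j + 1)) : Path X j := fun k =>
  if h : (k : ℕ) = j then cast (congrArg X h.symm) y
  else x ⟨k, lt_of_le_of_ne k.2 (Ne.symm h)⟩

theorem Path.head_cons {j : ℕ} (y : X j) (x : Path X (j + 1)) : (Path.cons y x).head = y := by
  simp [Path.head, Path.cons]

theorem Path.tail_cons {j : ℕ} (y : X j) (x : Path X (j + 1)) : (Path.cons y x).tail = x := by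
  ext k
  have : (k : ℕ) ≠ j := (Nat.lt_of_succ_le k.2).ne'
  simp [Path.tail, Path.cons, this]

theorem Path.cons_head_tail {j : ℕ} (x : Path X j) : Path.cons x.head x.tail = x := by
  ext ⟨k, hk⟩
  by_cases h : k = j
  · subst h
    simp [Path.cons]
  · simp [Path.cons, Path.tail, h]

section Measurable

variable [∀ j, MeasurableSpace (X j)]

theorem Path.measurable_tail {j : ℕ} : Measurable (Path.tail : Path X j → Path X (j + 1)) :=
  measurable_pi_lambda _ fun _ => measurable_pi_apply _

theorem Path.measurable_cons {j : ℕ} :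
    Measurable fun p : X j × Path X (j + 1) => Path.cons p.1 p.2 := by
  refine measurable_pi_lambda _ fun ⟨k, hk⟩ => ?_
  by_cases h : k = j
  · subst h
    simp only [Path.cons, dite_true]
    exact measurable_fst
  · simp only [Path.cons, h, dite_false]
    exact (measurable_pi_apply _).comp measurable_snd

end Measurable

/-! ### Path moduli and an equivalent gauge contracted in one step -/

section Modulus

variable [∀ j, MetricSpace (X j)]

/-- The modulus of the distance of the coordinates of two paths is in `[0, 1]`. -/
def UnitModulus (X : ℕ → Type u) [∀ j, MetricSpace (X j)] (ω : ℝ → ℝ) : Prop :=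
  ∀ (j : ℕ) (x y : X j), 0 ≤ ω (dist x y) ∧ ω (dist x y) ≤ 1

variable {ω : ℝ → ℝ} {a : ℝ}

theorem pathModulus_term_le_one (hω : UnitModulus X ω) (ha0 : 0 ≤ a) (ha1 : a ≤ 1) {j : ℕ}
    (x y : Path X j) (n : ℕ) :
    a ^ n * ω (dist (x ⟨j + n, Nat.le_add_right j n⟩) (y ⟨j + n, Nat.le_add_right j n⟩)) ≤ 1 :=
  mul_le_one₀ (pow_le_one₀ ha0 ha1) (hω _ _ _).1 (hω _ _ _).2

theorem le_pathModulus (hω : UnitModulus X ω) (ha0 : 0 ≤ a) (ha1 : a ≤ 1) {j : ℕ}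
    (x y : Path X j) (n : ℕ) :
    a ^ n * ω (dist (x ⟨j + n, Nat.le_add_right j n⟩) (y ⟨j + n, Nat.le_add_right j n⟩))
      ≤ pathModulus ω a j x y :=
  le_ciSup (f := fun n : ℕ => a ^ n * ω (dist (x ⟨j + n, Nat.le_add_right j n⟩)
    (y ⟨j + n, Nat.le_add_right j n⟩)))
    ⟨1, by rintro _ ⟨n, rfl⟩; exact pathModulus_term_le_one hω ha0 ha1 x y n⟩ n

theorem head_le_pathModulus (hω : UnitModulus X ω) (ha0 : 0 ≤ a) (ha1 : a ≤ 1) {j : ℕ}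
    (x y : Path X j) : ω (dist x.head y.head) ≤ pathModulus ω a j x y := by
  simpa using le_pathModulus hω ha0 ha1 x y 0

theorem pathModulus_nonneg (hω : UnitModulus X ω) (ha0 : 0 ≤ a) (ha1 : a ≤ 1) {j : ℕ}
    (x y : Path X j) : 0 ≤ pathModulus ω a j x y :=
  (hω _ _ _).1.trans (head_le_pathModulus hω ha0 ha1 x y)

theorem pathModulus_le_one (hω : UnitModulus X ω) (ha0 : 0 ≤ a) (ha1 : a ≤ 1) {j : ℕ}
    (x y : Path X j) : pathModulus ω a j x y ≤ 1 :=
  ciSup_le fun n => pathModulus_term_le_one hω ha0 ha1 x y n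

theorem pathModulus_le_add_tail (hω : UnitModulus X ω) (ha0 : 0 ≤ a) (ha1 : a ≤ 1) {j : ℕ}
    (x y : Path X j) : pathModulus ω a j x y
      ≤ ω (dist x.head y.head) + a * pathModulus ω a (j + 1) x.tail y.tail := by
  refine ciSup_le fun n => ?_
  cases n with
  | zero =>
    have := mul_nonneg ha0 (pathModulus_nonneg hω ha0 ha1 x.tail y.tail)
    simpa using this
  | succ n =>
    have h1 := mul_le_mul_of_nonneg_left (le_pathModulus hω ha0 ha1 x.tail y.tail n) ha0
    have e : (⟨j + 1 + n, (Nat.le_succ j).trans (Nat.le_add_right (j + 1) n)⟩ : Set.Ici j)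
        = ⟨j + (n + 1), Nat.le_add_right j (n + 1)⟩ := Subtype.ext (by simp only; omega)
    have e2 := congrArg (fun k : Set.Ici j => ω (dist (x k) (y k))) e
    have h0 := (hω _ x.head y.head).1
    simp only [Path.tail] at h1 e2
    rw [e2, ← mul_assoc, ← pow_succ'] at h1
    linarith

theorem mul_pathModulus_tail_le (hω : UnitModulus X ω) (ha0 : 0 ≤ a) (ha1 : a ≤ 1) {j : ℕ}
    (x y : Path X j) :
    a * pathModulus ω a (j + 1) x.tail y.tail ≤ pathModulus ω a j x y := by
  rw [pathModulus, Real.mul_iSup_of_nonneg ha0]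
  refine ciSup_le fun n => ?_
  have h1 := le_pathModulus hω ha0 ha1 x y (n + 1)
  have e : (⟨j + 1 + n, (Nat.le_succ j).trans (Nat.le_add_right (j + 1) n)⟩ : Set.Ici j)
      = ⟨j + (n + 1), Nat.le_add_right j (n + 1)⟩ := Subtype.ext (by simp only; omega)
  have e2 := congrArg (fun k : Set.Ici j => ω (dist (x k) (y k))) e
  simp only [Path.tail] at e2 ⊢
  rw [e2, ← mul_assoc, ← pow_succ']
  exact h1

/-- A gauge equivalent to `pathModulus`, for which averaging is contracting in one step. -/
def pathGauge (ω : ℝ → ℝ) (a K : ℝ) (j : ℕ) (x y : Path X j) : ℝ :=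
  (K * ω (dist x.head y.head) + pathModulus ω a (j + 1) x.tail y.tail) / (K + 1)

theorem pathModulus_le_pathGauge (hω : UnitModulus X ω) (ha0 : 0 ≤ a) (ha1 : a ≤ 1) {K : ℝ}
    (hK : 1 ≤ K) {j : ℕ} (x y : Path X j) :
    pathModulus ω a j x y ≤ (K + 1) * pathGauge ω a K j x y := by
  rw [pathGauge, mul_div_cancel₀ _ (by positivity)]
  have h1 := pathModulus_le_add_tail hω ha0 ha1 x y
  have h2 := (hω _ x.head y.head).1
  have h3 := pathModulus_nonneg hω ha0 ha1 x.tail y.tail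
  nlinarith

theorem pathGauge_shift_le (hω : UnitModulus X ω) (ha0 : 0 < a) (ha1 : a ≤ 1) {K : ℝ}
    (hK : 1 ≤ K) {j : ℕ} (x y : Path X j) :
    pathGauge ω a K (j + 1) x.tail y.tail ≤ (K + 1 / a) * pathGauge ω a K j x y := by
  have h1 := head_le_pathModulus hω ha0.le ha1 x.tail y.tail
  have h2 := mul_pathModulus_tail_le hω ha0.le ha1 x.tail y.tail
  have h3 := (hω _ x.head y.head).1
  have h4 : pathModulus ω a (j + 1 + 1) x.tail.tail y.tail.tail
      ≤ 1 / a * pathModulus ω a (j + 1) x.tail y.tail := by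
    rw [one_div, inv_mul_eq_div, le_div_iff₀ ha0, mul_comm]; exact h2
  have h5 : 0 ≤ (K + 1 / a) * (K * ω (dist x.head y.head)) := by positivity
  rw [pathGauge, pathGauge, ← mul_div_assoc]
  gcongr
  nlinarith

end Modulus

/-! ### The Markov chain as a contracting tower -/

section Tower

variable [∀ j, MetricSpace (X j)] [∀ j, MeasurableSpace (X j)] {Ω : Type*} [MeasurableSpace Ω]
  {μ : Measure Ω} [IsProbabilityMeasure μ] {ξ : (j : ℕ) → Ω → X j}
  {P : (j : ℕ) → Kernel (X (j + 1)) (X j)} [∀ j, IsMarkovKernel (P j)] {ω : ℝ → ℝ} {a : ℝ}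

/-- The conditional law of the path from time `j` on, given the path from time `j + 1` on. -/
def pathFiber (P : (j : ℕ) → Kernel (X (j + 1)) (X j)) (j : ℕ) (x : Path X (j + 1)) :
    Measure (Path X j) :=
  (P j x.head).map fun y => Path.cons y x

theorem measurable_cons_left {j : ℕ} (x : Path X (j + 1)) :
    Measurable fun y : X j => Path.cons y x :=
  Path.measurable_cons.comp (measurable_id.prodMk measurable_const)

theorem integral_pathFiber {j : ℕ} (x : Path X (j + 1)) {g : Path X j → ℂ} (hg : Measurable g) :
    ∫ y, g y ∂pathFiber P j x = ∫ y, g (Path.cons y x) ∂P j x.head :=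
  integral_map (measurable_cons_left x).aemeasurable hg.aestronglyMeasurable

theorem IsMarkovChain.disintegration (hξ : IsMarkovChain μ ξ P) (j : ℕ) {g : Path X j → ℂ}
    {B : ℝ} (hg : Measurable g) (hB : ∀ y, ‖g y‖ ≤ B) :
    ∫ w, g (fun k => ξ k w) ∂μ = ∫ w, ∫ y, g y ∂pathFiber P j (fun k => ξ k w) ∂μ := by
  have hp := hξ.measurable_path (j + 1)
  have hpm := hp.prodMk (hξ.measurable j)
  have : IsProbabilityMeasure (μ.map fun w (k : Set.Ici (j + 1)) => ξ k w) :=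
    Measure.isProbabilityMeasure_map hp.aemeasurable
  have hG : Measurable fun p : Path X (j + 1) × X j => g (Path.cons p.2 p.1) :=
    hg.comp (Path.measurable_cons.comp measurable_swap)
  have e1 : ∀ w, g (fun k => ξ k w) = g (Path.cons (ξ j w) (fun k => ξ k w)) := fun w =>
    congrArg g (Path.cons_head_tail (fun k : Set.Ici j => ξ k w)).symm
  have e2 := integral_map (μ := μ) hpm.aemeasurable hG.aestronglyMeasurable
  have hκm : Measurable fun x : Path X (j + 1) => x ⟨j + 1, Set.self_mem_Ici⟩ :=
    measurable_pi_apply _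
  simp only [e1]
  rw [← e2, hξ.map_path_prod j, Measure.integral_compProd
    (Integrable.of_bound hG.aestronglyMeasurable B (ae_of_all _ fun p => hB _)),
    integral_map hp.aemeasurable]
  · exact integral_congr_ae (ae_of_all _ fun w => (integral_pathFiber (P := P)
      (fun k : Set.Ici (j + 1) => ξ k w) hg).symm)
  · exact (hG.stronglyMeasurable.integral_kernel_prod_right'
      (κ := (P j).comap _ hκm)).aestronglyMeasurable

theorem isContractingTower (hξ : IsMarkovChain μ ξ P) (hω : UnitModulus X ω) (hω0 : ω 0 = 0)
    (ha0 : 0 < a) (ha1 : a < 1) (hP : EquicontinuousKernels ω P) :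
    ∃ K θ C : ℝ, 1 ≤ K ∧ IsContractingTower (Y := Path X) μ (fun j w k => ξ k w)
      (fun _ => Path.tail) (pathFiber P) (pathGauge ω a K) θ C := by
  obtain ⟨δ, hδ0, hδ1, hδ⟩ := hP
  have hd : 0 < 1 - δ := sub_pos.2 hδ1
  -- `K` solves `1 + δ (K + 1) = (1 + δ) / 2 * K`. Weighting the first coordinate this heavily
  -- absorbs the unit contribution it makes to the modulus of the longer path, so that one step
  -- contracts.
  set K := 2 * (1 + δ) / (1 - δ) with hKdef
  have hK : 1 ≤ K := by rw [hKdef, le_div_iff₀ hd]; linarith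
  have hKe : K * (1 - δ) = 2 * (1 + δ) := div_mul_cancel₀ _ hd.ne'
  refine ⟨K, max a ((1 + δ) / 2), K + 1 / a, hK, ?_⟩
  refine
    { measurable_proc := hξ.measurable_path
      measurable_shift := fun j => Path.measurable_tail
      shift_proc := fun j w => rfl
      prob := fun j x => Measure.isProbabilityMeasure_map (measurable_cons_left x).aemeasurable
      measurable_average := fun j g hg => ?_
      average_mul := fun j x g φ hg hφ => ?_
      disintegration := fun j g B hg hB => hξ.disintegration j hg hB
      gauge_nonneg := fun j x y => ?_
      gauge_le_one := fun j x y => ?_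
      gauge_shift := fun j x y => pathGauge_shift_le hω ha0 ha1.le hK x y
      const_nonneg := by positivity
      rate_nonneg := le_max_of_le_left ha0.le
      rate_lt_one := max_lt ha1 (by linarith)
      contract := fun j g N hg hN hL x y => ?_ }
  · simp only [integral_pathFiber _ hg]
    have hG : Measurable fun p : Path X (j + 1) × X j => g (Path.cons p.2 p.1) :=
      hg.comp (Path.measurable_cons.comp measurable_swap)
    have hκm : Measurable fun x : Path X (j + 1) => x.head := measurable_pi_apply _
    exact (hG.stronglyMeasurable.integral_kernel_prod_right'
      (κ := (P j).comap _ hκm)).measurable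
  · have hgφ : Measurable fun y => g y * φ y.tail := hg.mul (hφ.comp Path.measurable_tail)
    rw [integral_pathFiber _ hgφ, integral_pathFiber _ hg]
    simp only [Path.tail_cons]
    exact integral_mul_const _ _
  · have h2 := (hω _ x.head y.head).1
    have h3 := pathModulus_nonneg hω ha0.le ha1.le x.tail y.tail
    rw [pathGauge]
    positivity
  · have h2 := (hω _ x.head y.head).2
    have h3 := pathModulus_le_one hω ha0.le ha1.le x.tail y.tail
    rw [pathGauge, div_le_one (by positivity)]
    nlinarith
  · set θ := max a ((1 + δ) / 2)
    have hcons : ∀ z, ‖g (Path.cons z x) - g (Path.cons z y)‖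
        ≤ N * (pathModulus ω a (j + 1) x y / (K + 1)) := fun z => by
      have := hL (Path.cons z x) (Path.cons z y)
      simpa only [pathGauge, Path.head_cons, Path.tail_cons, dist_self, hω0, mul_zero,
        zero_add] using this
    have hosc : ∀ u v, ‖g u - g v‖ ≤ N := fun u v => by
      refine (hL u v).trans (mul_le_of_le_one_right hN ?_)
      have h2 := (hω _ u.head v.head).2
      have h3 := pathModulus_le_one hω ha0.le ha1.le u.tail v.tail
      rw [pathGauge, div_le_one (by positivity)]
      nlinarith
    have hgm : ∀ u : Path X (j + 1), Measurable fun z : X j => g (Path.cons z u) := fun u =>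
      hg.comp (measurable_cons_left u)
    have hgi : ∀ (u : Path X (j + 1)) (v : X (j + 1)),
        Integrable (fun z => g (Path.cons z u)) (P j v) := fun u v => by
      have : Nonempty (X j) := nonempty_of_isProbabilityMeasure (P j v)
      obtain ⟨z₀⟩ := this
      refine Integrable.of_bound (hgm u).aestronglyMeasurable (N + ‖g (Path.cons z₀ u)‖)
        (ae_of_all _ fun z => ?_)
      calc ‖g (Path.cons z u)‖
          = ‖(g (Path.cons z u) - g (Path.cons z₀ u)) + g (Path.cons z₀ u)‖ := by
            rw [sub_add_cancel]
        _ ≤ _ := norm_add_le _ _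
        _ ≤ _ := by gcongr; exact hosc _ _
    rw [integral_pathFiber _ hg, integral_pathFiber _ hg]
    -- Change the path while keeping the kernel's base point: the common new first coordinate
    -- contributes nothing to the gauge. Then change the base point, at the price of a total
    -- variation distance.
    have h1 : ‖∫ z, g (Path.cons z x) ∂P j x.head - ∫ z, g (Path.cons z y) ∂P j x.head‖
        ≤ N * (pathModulus ω a (j + 1) x y / (K + 1)) := by
      rw [← integral_sub (hgi x _) (hgi y _)]
      simpa using norm_integral_le_of_norm_le_const (μ := P j x.head) (ae_of_all _ hcons)
    have h2 : ‖∫ z, g (Path.cons z y) ∂P j x.head - ∫ z, g (Path.cons z y) ∂P j y.head‖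
        ≤ N * (δ * ω (dist x.head y.head)) :=
      (norm_integral_sub_integral_le_tvDist (hgm y) fun u v => hosc _ _).trans
        (mul_le_mul_of_nonneg_left (hδ j _ _) hN)
    have h3 := pathModulus_le_add_tail hω ha0.le ha1.le x y
    have h4 := (hω _ x.head y.head).1
    have h5 := pathModulus_nonneg hω ha0.le ha1.le x.tail y.tail
    refine (norm_sub_le_norm_sub_add_norm_sub _ (∫ z, g (Path.cons z y) ∂P j x.head) _).trans
      ((add_le_add h1 h2).trans ?_)
    rw [← mul_add, mul_comm θ N, mul_assoc]
    refine mul_le_mul_of_nonneg_left ?_ hN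
    rw [pathGauge, ← mul_div_assoc, div_add' _ _ _ (by positivity)]
    gcongr
    have h6 : a * pathModulus ω a (j + 1 + 1) x.tail y.tail
        ≤ θ * pathModulus ω a (j + 1 + 1) x.tail y.tail :=
      mul_le_mul_of_nonneg_right (le_max_left _ _) h5
    have h7 : (1 + δ) / 2 * (K * ω (dist x.head y.head))
        ≤ θ * (K * ω (dist x.head y.head)) :=
      mul_le_mul_of_nonneg_right (le_max_right _ _) (by positivity)
    have h8 : 1 + δ * (K + 1) = (1 + δ) / 2 * K := by linarith
    have h9 : ω (dist x.head y.head) + δ * ω (dist x.head y.head) * (K + 1)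
        = (1 + δ) / 2 * (K * ω (dist x.head y.head)) := by
      rw [← mul_assoc, ← h8]; ring
    linarith

end Tower

end MarkovShift

/-! ### Tightness and the reduction group -/

namespace MarkovShift

universe u v

theorem norm_eLpNorm_two_sq {Ω : Type*} [MeasurableSpace Ω] {μ : Measure Ω} {Z : Ω → ℝ}
    (hZ : MemLp Z 2 μ) : (eLpNorm Z 2 μ).toReal ^ 2 = ∫ w, Z w ^ 2 ∂μ := by
  have h0 : 0 ≤ ∫ w, Z w ^ 2 ∂μ := integral_nonneg fun w => sq_nonneg _
  rw [hZ.eLpNorm_eq_integral_rpow_norm (by norm_num) (by norm_num)]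
  simp only [ENNReal.toReal_ofNat, Real.rpow_two, Real.norm_eq_abs, sq_abs]
  rw [ENNReal.toReal_ofReal (by positivity), ← Real.rpow_natCast, ← Real.rpow_mul h0]
  norm_num

/-! ### Tightness of real random variables -/

section Tight

variable {Ω : Type*} [MeasurableSpace Ω] {μ : Measure Ω} [IsProbabilityMeasure μ]

theorem isTightMeasureSet_map_iff {Z : ℕ → Ω → ℝ} (hZ : ∀ n, Measurable (Z n)) :
    IsTightMeasureSet ((fun n : ℕ => μ.map (Z n)) '' Set.Ici 1) ↔
      ∀ ε : ℝ, 0 < ε → ∃ R : ℝ, 0 ≤ R ∧ ∀ n, 1 ≤ n → μ.real {w | R < |Z n w|} ≤ ε := by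
  rw [isTightMeasureSet_iff_exists_isCompact_measure_compl_le]
  constructor
  · intro h ε hε
    obtain ⟨K, hK, hKμ⟩ := h (ENNReal.ofReal ε) (ENNReal.ofReal_pos.2 hε)
    obtain ⟨R, hR⟩ := hK.isBounded.exists_norm_le
    refine ⟨max R 0, le_max_right _ _, fun n hn => ?_⟩
    have h1 := hKμ _ ⟨n, hn, rfl⟩
    rw [Measure.map_apply (hZ n) hK.measurableSet.compl] at h1
    refine ENNReal.toReal_le_of_le_ofReal hε.le ((measure_mono fun w hw hwK => ?_).trans h1)
    exact absurd (hR _ hwK) (not_le.2 ((le_max_left R 0).trans_lt hw))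
  · intro h ε hε
    rcases eq_or_ne ε ∞ with rfl | hε'
    · exact ⟨∅, isCompact_empty, fun _ _ => le_top⟩
    obtain ⟨R, -, hR⟩ := h ε.toReal (ENNReal.toReal_pos hε.ne' hε')
    refine ⟨Set.Icc (-R) R, isCompact_Icc, ?_⟩
    rintro _ ⟨n, hn, rfl⟩
    rw [Measure.map_apply (hZ n) measurableSet_Icc.compl]
    refine (measure_mono fun w hw => ?_).trans
      ((ENNReal.le_ofReal_iff_toReal_le (measure_ne_top _ _) ENNReal.toReal_nonneg).2 (hR n hn)
        |>.trans_eq (ENNReal.ofReal_toReal hε'))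
    by_contra hc
    exact hw (abs_le.1 (not_lt.1 hc))

theorem tight_of_integral_sq_le {Z : ℕ → Ω → ℝ} (hZ : ∀ n, Measurable (Z n))
    (hi : ∀ n, Integrable (fun w => Z n w ^ 2) μ) {D : ℝ} (hD : ∀ n, ∫ w, Z n w ^ 2 ∂μ ≤ D) :
    IsTightMeasureSet ((fun n : ℕ => μ.map (Z n)) '' Set.Ici 1) := by
  rw [isTightMeasureSet_map_iff hZ]
  intro ε hε
  have hD0 : 0 ≤ D := (integral_nonneg fun w => sq_nonneg (Z 0 w)).trans (hD 0)
  -- The added `1` ensures that the level is at most its own square; Chebyshev's inequality at this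
  -- level then gives a tail of at most `ε`.
  refine ⟨D / ε + 1, by positivity, fun n _ => ?_⟩
  have hR1 : 1 ≤ D / ε + 1 := by linarith [div_nonneg hD0 hε.le]
  have h1 := mul_meas_ge_le_integral_of_nonneg (ae_of_all μ fun w => sq_nonneg (Z n w)) (hi n)
    (D / ε + 1)
  have h2 : μ.real {w | D / ε + 1 < |Z n w|} ≤ μ.real {w | D / ε + 1 ≤ Z n w ^ 2} := by
    refine measureReal_mono fun w hw => ?_
    have hw' : D / ε + 1 < |Z n w| := hw
    change D / ε + 1 ≤ Z n w ^ 2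
    rw [← sq_abs]
    nlinarith
  refine h2.trans ?_
  have h3 : (D / ε + 1) * μ.real {w | D / ε + 1 ≤ Z n w ^ 2} ≤ D := h1.trans (hD n)
  have h4 : (D / ε + 1) * ε = D + ε := by field_simp
  have h5 : (0 : ℝ) ≤ μ.real {w | D / ε + 1 ≤ Z n w ^ 2} := measureReal_nonneg
  by_contra hc
  nlinarith [not_le.1 hc]

theorem tight_linear_combination {Z Z' : ℕ → Ω → ℝ} (hZ : ∀ n, Measurable (Z n))
    (hZ' : ∀ n, Measurable (Z' n))
    (h : IsTightMeasureSet ((fun n : ℕ => μ.map (Z n)) '' Set.Ici 1))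
    (h' : IsTightMeasureSet ((fun n : ℕ => μ.map (Z' n)) '' Set.Ici 1)) (b b' : ℝ) :
    IsTightMeasureSet
      ((fun n : ℕ => μ.map fun w => b * Z n w + b' * Z' n w) '' Set.Ici 1) := by
  rw [isTightMeasureSet_map_iff hZ] at h
  rw [isTightMeasureSet_map_iff hZ'] at h'
  have hm : ∀ n, Measurable fun w => b * Z n w + b' * Z' n w :=
    fun n => ((hZ n).const_mul b).add ((hZ' n).const_mul b')
  rw [isTightMeasureSet_map_iff hm]
  intro ε hε
  obtain ⟨R, hR0, hR⟩ := h (ε / 2) (half_pos hε)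
  obtain ⟨R', hR0', hR'⟩ := h' (ε / 2) (half_pos hε)
  refine ⟨|b| * R + |b'| * R', by positivity, fun n hn => ?_⟩
  refine (measureReal_mono (s₂ := {w | R < |Z n w|} ∪ {w | R' < |Z' n w|})
    fun w hw => ?_).trans ((measureReal_union_le _ _).trans (by linarith [hR n hn, hR' n hn]))
  by_contra hc
  simp only [Set.mem_union, Set.mem_ofPred_eq, not_or, not_lt] at hc
  have h1 : |b * Z n w + b' * Z' n w| ≤ |b| * R + |b'| * R' := by
    refine (abs_add_le _ _).trans ?_
    rw [abs_mul, abs_mul]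
    gcongr
    exacts [hc.1, hc.2]
  exact absurd hw (not_lt.2 h1)

end Tight

/-! ### Pointwise bounds, centred sums and the group of reduction steps -/

section Reduction

variable {X : ℕ → Type u} [∀ j, MetricSpace (X j)] [∀ j, MeasurableSpace (X j)] {Ω : Type v}
  [MeasurableSpace Ω] {μ : Measure Ω} [IsProbabilityMeasure μ] {ξ : (j : ℕ) → Ω → X j}
  {P : (j : ℕ) → Kernel (X (j + 1)) (X j)} [∀ j, IsMarkovKernel (P j)] {ω : ℝ → ℝ} {a : ℝ}

theorem variation_le_iff (hω : UnitModulus X ω) (ha0 : 0 ≤ a) (ha1 : a ≤ 1) {j : ℕ}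
    {g : Path X j → ℝ} {V : ℝ} (hV : 0 ≤ V) :
    variation ω a j g ≤ ENNReal.ofReal V ↔
      ∀ x y, |g x - g y| ≤ V * pathModulus ω a j x y := by
  simp only [variation, iSup_le_iff]
  refine forall₂_congr fun x y => ?_
  have h0 := pathModulus_nonneg hω ha0 ha1 x y
  rcases eq_or_ne x y with rfl | hxy
  · simp [mul_nonneg hV h0]
  · simp only [ne_eq, hxy, not_false_eq_true, forall_const]
    rcases h0.eq_or_lt with h | h
    · rw [← h, mul_zero, ENNReal.ofReal_zero]
      constructor
      · intro h1
        by_contra hc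
        rw [ENNReal.div_zero (by simpa using not_le.1 hc)] at h1
        simp at h1
      · intro h1
        rw [ENNReal.ofReal_of_nonpos h1]
        simp
    · rw [← ENNReal.ofReal_div_of_pos h, ENNReal.ofReal_le_ofReal_iff hV, div_le_iff₀ h]

theorem IsMarkovChain.isProbabilityMeasure_pathLaw (hξ : IsMarkovChain μ ξ P) (j : ℕ) :
    IsProbabilityMeasure (pathLaw μ ξ j) :=
  Measure.isProbabilityMeasure_map (hξ.measurable_path j).aemeasurable

/-- Uniform boundedness in terms of pointwise estimates. -/
theorem uniformlyBounded_iff (hξ : IsMarkovChain μ ξ P) (hω : UnitModulus X ω) (ha0 : 0 ≤ a)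
    (ha1 : a ≤ 1) {g : (j : ℕ) → Path X j → ℝ} :
    UniformlyBounded ω a μ ξ g ↔ (∀ j, Measurable (g j)) ∧ ∃ B, 0 ≤ B ∧
      (∀ j x, |g j x| ≤ B) ∧ ∀ j x y, |g j x - g j y| ≤ B * pathModulus ω a j x y := by
  refine and_congr_right fun hg => ⟨fun h => ?_, ?_⟩
  · set N := (⨆ j, pathNorm ω a μ ξ j (g j)).toReal
    have hN0 : 0 ≤ N := ENNReal.toReal_nonneg
    have hle : ∀ j, pathNorm ω a μ ξ j (g j) ≤ ENNReal.ofReal N := fun j => by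
      rw [ENNReal.ofReal_toReal h.ne]
      exact le_iSup (fun j => pathNorm ω a μ ξ j (g j)) j
    have hvar : ∀ j x y, |g j x - g j y| ≤ N * pathModulus ω a j x y := fun j =>
      (variation_le_iff hω ha0 ha1 hN0).1 (le_add_self.trans (hle j))
    refine ⟨N + N, by positivity, fun j x => ?_, fun j x y => (hvar j x y).trans ?_⟩
    · have := hξ.isProbabilityMeasure_pathLaw j
      have h1 : eLpNormEssSup (g j) (pathLaw μ ξ j) ≤ ENNReal.ofReal N := by
        rw [← eLpNorm_exponent_top]
        exact le_self_add.trans (hle j)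
      -- The essential bound holds at some point, and the variation controls the oscillation because
      -- the modulus is at most one. Hence the bound `N + N` holds everywhere.
      obtain ⟨y, hy⟩ := (ae_le_eLpNormEssSup (f := g j) (μ := pathLaw μ ξ j)).exists
      have h2 : |g j y| ≤ N := by
        have := hy.trans h1
        rwa [Real.enorm_eq_ofReal_abs, ENNReal.ofReal_le_ofReal_iff hN0] at this
      have h3 := (hvar j x y).trans (mul_le_of_le_one_right hN0
        (pathModulus_le_one hω ha0 ha1 x y))
      calc |g j x| = |(g j x - g j y) + g j y| := by rw [sub_add_cancel]
        _ ≤ _ := abs_add_le _ _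
        _ ≤ _ := add_le_add h3 h2
    · have := mul_nonneg hN0 (pathModulus_nonneg hω ha0 ha1 x y)
      linarith
  · rintro ⟨B, hB0, hB, hL⟩
    refine (iSup_le fun j => ?_ : _ ≤ ENNReal.ofReal B + ENNReal.ofReal B).trans_lt
      (by simp)
    refine add_le_add ?_ ((variation_le_iff hω ha0 ha1 hB0).2 (hL j))
    rw [eLpNorm_exponent_top]
    exact eLpNormEssSup_le_of_ae_bound (ae_of_all _ fun x => hB j x)

theorem UniformlyBounded.linear_combination (hξ : IsMarkovChain μ ξ P) (hω : UnitModulus X ω)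
    (ha0 : 0 ≤ a) (ha1 : a ≤ 1) {g g' : (j : ℕ) → Path X j → ℝ}
    (hg : UniformlyBounded ω a μ ξ g) (hg' : UniformlyBounded ω a μ ξ g') (b b' : ℝ) :
    UniformlyBounded ω a μ ξ fun j x => b * g j x + b' * g' j x := by
  rw [uniformlyBounded_iff hξ hω ha0 ha1] at *
  obtain ⟨hm, B, hB0, hB, hL⟩ := hg
  obtain ⟨hm', B', hB0', hB', hL'⟩ := hg'
  refine ⟨fun j => ((hm j).const_mul b).add ((hm' j).const_mul b'), |b| * B + |b'| * B',
    by positivity, fun j x => ?_, fun j x y => ?_⟩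
  · refine (abs_add_le _ _).trans ?_
    rw [abs_mul, abs_mul]
    gcongr
    exacts [hB j x, hB' j x]
  · have e : b * g j x + b' * g' j x - (b * g j y + b' * g' j y)
        = b * (g j x - g j y) + b' * (g' j x - g' j y) := by ring
    rw [e, add_mul, mul_assoc, mul_assoc]
    refine (abs_add_le _ _).trans ?_
    rw [abs_mul, abs_mul]
    gcongr
    exacts [hL j x y, hL' j x y]

/-- Subtracting the means. -/
def centre (μ : Measure Ω) (ξ : (j : ℕ) → Ω → X j) (g : (j : ℕ) → Path X j → ℝ) (j : ℕ)
    (x : Path X j) : ℝ :=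
  g j x - ∫ y, g j y ∂pathLaw μ ξ j

theorem UniformlyBounded.integrable (hξ : IsMarkovChain μ ξ P) (hω : UnitModulus X ω)
    (ha0 : 0 ≤ a) (ha1 : a ≤ 1) {g : (j : ℕ) → Path X j → ℝ}
    (hg : UniformlyBounded ω a μ ξ g) (j : ℕ) : Integrable (g j) (pathLaw μ ξ j) := by
  have := hξ.isProbabilityMeasure_pathLaw j
  obtain ⟨hm, B, -, hB, -⟩ := (uniformlyBounded_iff hξ hω ha0 ha1).1 hg
  exact Integrable.of_bound (hm j).aestronglyMeasurable B (ae_of_all _ (hB j))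

theorem UniformlyBounded.centre (hξ : IsMarkovChain μ ξ P) (hω : UnitModulus X ω)
    (ha0 : 0 ≤ a) (ha1 : a ≤ 1) {g : (j : ℕ) → Path X j → ℝ}
    (hg : UniformlyBounded ω a μ ξ g) : UniformlyBounded ω a μ ξ (centre μ ξ g) := by
  rw [uniformlyBounded_iff hξ hω ha0 ha1] at *
  obtain ⟨hm, B, hB0, hB, hL⟩ := hg
  refine ⟨fun j => (hm j).sub_const _, B + B, by positivity, fun j x => ?_, fun j x y => ?_⟩
  · have := hξ.isProbabilityMeasure_pathLaw j
    have h1 : ‖∫ y, g j y ∂pathLaw μ ξ j‖ ≤ B := by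
      simpa using norm_integral_le_of_norm_le_const (μ := pathLaw μ ξ j) (f := g j) (C := B)
        (ae_of_all _ fun y => (Real.norm_eq_abs _).le.trans (hB j y))
    exact (abs_sub _ _).trans (add_le_add (hB j x) h1)
  · simp only [MarkovShift.centre, sub_sub_sub_cancel_right]
    refine (hL j x y).trans ?_
    have := mul_nonneg hB0 (pathModulus_nonneg hω ha0 ha1 x y)
    linarith

theorem integral_centre (hξ : IsMarkovChain μ ξ P) (hω : UnitModulus X ω)
    (ha0 : 0 ≤ a) (ha1 : a ≤ 1) {g : (j : ℕ) → Path X j → ℝ}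
    (hg : UniformlyBounded ω a μ ξ g) (j : ℕ) :
    ∫ w, centre μ ξ g j (fun k => ξ k w) ∂μ = 0 := by
  have := hξ.isProbabilityMeasure_pathLaw j
  have h1 := integral_map (μ := μ) (hξ.measurable_path j).aemeasurable
    ((hg.centre hξ hω ha0 ha1).1 j).aestronglyMeasurable
  have h2 : ∫ y, centre μ ξ g j y ∂pathLaw μ ξ j = 0 := by
    simp only [centre]
    rw [integral_sub (hg.integrable hξ hω ha0 ha1 j) (integrable_const _)]
    simp
  exact h1.symm.trans h2

theorem partialSum_centre (g : (j : ℕ) → Path X j → ℝ) (n : ℕ) (w : Ω) :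
    partialSum ξ (centre μ ξ g) n w
      = partialSum ξ g n w - ∑ j ∈ Finset.range n, ∫ y, g j y ∂pathLaw μ ξ j := by
  simp only [partialSum, centre, Finset.sum_sub_distrib]

theorem UniformlyBounded.measurable_partialSum (hξ : IsMarkovChain μ ξ P)
    {g : (j : ℕ) → Path X j → ℝ} (hg : UniformlyBounded ω a μ ξ g) (n : ℕ) :
    Measurable (partialSum ξ g n) :=
  Finset.measurable_sum _ fun j _ => (hg.1 j).comp (hξ.measurable_path j)

theorem UniformlyBounded.exists_abs_partialSum_le (hξ : IsMarkovChain μ ξ P)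
    (hω : UnitModulus X ω) (ha0 : 0 ≤ a) (ha1 : a ≤ 1) {g : (j : ℕ) → Path X j → ℝ}
    (hg : UniformlyBounded ω a μ ξ g) (n : ℕ) : ∃ B, ∀ w, |partialSum ξ g n w| ≤ B := by
  obtain ⟨-, B, -, hB, -⟩ := (uniformlyBounded_iff hξ hω ha0 ha1).1 hg
  refine ⟨n * B, fun w => (Finset.abs_sum_le_sum_abs _ _).trans ?_⟩
  simpa using Finset.sum_le_card_nsmul (Finset.range n) _ B fun i _ => hB i _

theorem UniformlyBounded.memLp_partialSum (hξ : IsMarkovChain μ ξ P) (hω : UnitModulus X ω)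
    (ha0 : 0 ≤ a) (ha1 : a ≤ 1) {g : (j : ℕ) → Path X j → ℝ}
    (hg : UniformlyBounded ω a μ ξ g) (n : ℕ) : MemLp (partialSum ξ g n) 2 μ := by
  obtain ⟨B, hB⟩ := hg.exists_abs_partialSum_le hξ hω ha0 ha1 n
  exact MemLp.of_bound (hg.measurable_partialSum hξ n).aestronglyMeasurable B (ae_of_all _ hB)

theorem sigma_sq (hξ : IsMarkovChain μ ξ P) (hω : UnitModulus X ω)
    (ha0 : 0 ≤ a) (ha1 : a ≤ 1) {g : (j : ℕ) → Path X j → ℝ}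
    (hg : UniformlyBounded ω a μ ξ g) (n : ℕ) :
    sigma μ ξ g n ^ 2 = ∫ w, partialSum ξ (centre μ ξ g) n w ^ 2 ∂μ := by
  have hc := hg.centre hξ hω ha0 ha1
  have e : ∀ w, partialSum ξ g n w - ∫ w', partialSum ξ g n w' ∂μ
      = partialSum ξ (centre μ ξ g) n w := fun w => by
    have h1 : ∫ w', partialSum ξ g n w' ∂μ
        = ∑ j ∈ Finset.range n, ∫ y, g j y ∂pathLaw μ ξ j := by
      simp only [partialSum]
      rw [integral_finsetSum]
      · exact Finset.sum_congr rfl fun j _ => (integral_map (hξ.measurable_path j).aemeasurable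
          (hg.1 j).aestronglyMeasurable).symm
      · exact fun j _ => (integrable_map_measure (hg.1 j).aestronglyMeasurable
          (hξ.measurable_path j).aemeasurable).1 (hg.integrable hξ hω ha0 ha1 j)
    rw [h1, partialSum_centre]
  rw [sigma, funext e, norm_eLpNorm_two_sq (hc.memLp_partialSum hξ hω ha0 ha1 n)]

/-- The centred partial sums are bounded in `L²`. -/
def CentredSumsBounded (μ : Measure Ω) (ξ : (j : ℕ) → Ω → X j) (g : (j : ℕ) → Path X j → ℝ) :
    Prop :=
  ∃ D, ∀ n, ∫ w, partialSum ξ (centre μ ξ g) n w ^ 2 ∂μ ≤ D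

theorem CentredSumsBounded.not_tendsto_sigma (hξ : IsMarkovChain μ ξ P) (hω : UnitModulus X ω)
    (ha0 : 0 ≤ a) (ha1 : a ≤ 1) {g : (j : ℕ) → Path X j → ℝ}
    (hg : UniformlyBounded ω a μ ξ g) (h : CentredSumsBounded μ ξ g) :
    ¬ Tendsto (sigma μ ξ g) atTop atTop := by
  intro ht
  obtain ⟨D, hD⟩ := h
  obtain ⟨n, hn⟩ := (ht.eventually_ge_atTop (|D| + 1)).exists
  have h1 := hD n
  rw [← sigma_sq hξ hω ha0 ha1 hg n] at h1
  nlinarith [le_abs_self D, abs_nonneg D]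

theorem CentredSumsBounded.tight (hξ : IsMarkovChain μ ξ P) (hω : UnitModulus X ω)
    (ha0 : 0 ≤ a) (ha1 : a ≤ 1) {g : (j : ℕ) → Path X j → ℝ}
    (hg : UniformlyBounded ω a μ ξ g) (h : CentredSumsBounded μ ξ g) :
    IsTightMeasureSet ((fun n : ℕ => μ.map (partialSum ξ (centre μ ξ g) n)) '' Set.Ici 1) := by
  obtain ⟨D, hD⟩ := h
  have hc := hg.centre hξ hω ha0 ha1
  exact tight_of_integral_sq_le (hc.measurable_partialSum hξ)
    (fun n => (hc.memLp_partialSum hξ hω ha0 ha1 n).integrable_sq) hD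

theorem UniformlyBounded.exists_isRegularFamily {K : ℝ} (hK : 1 ≤ K)
    (hξ : IsMarkovChain μ ξ P) (hω : UnitModulus X ω)
    (ha0 : 0 ≤ a) (ha1 : a ≤ 1) {g : (j : ℕ) → Path X j → ℝ}
    (hg : UniformlyBounded ω a μ ξ g) :
    ∃ K', 0 ≤ K' ∧ IsRegularFamily (Y := Path X) (pathGauge ω a K) (MarkovShift.centre μ ξ g)
      K' := by
  obtain ⟨hm, B, hB0, hB, hL⟩ :=
    (uniformlyBounded_iff hξ hω ha0 ha1).1 (hg.centre hξ hω ha0 ha1)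
  refine ⟨B * (K + 1), by positivity, hm, fun j x => ?_, fun j x y => ?_⟩
  · exact (hB j x).trans (le_mul_of_one_le_right hB0 (by linarith))
  · refine (hL j x y).trans ?_
    rw [mul_assoc]
    gcongr
    exact pathModulus_le_pathGauge hω ha0 ha1 hK x y

theorem centredSumsBounded_of_not_tendsto (hξ : IsMarkovChain μ ξ P) (hω : UnitModulus X ω)
    (hω0 : ω 0 = 0) (ha0 : 0 < a) (ha1 : a < 1) (hP : EquicontinuousKernels ω P)
    {g : (j : ℕ) → Path X j → ℝ} (hg : UniformlyBounded ω a μ ξ g)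
    (h : ¬ Tendsto (sigma μ ξ g) atTop atTop) : CentredSumsBounded μ ξ g := by
  obtain ⟨K, θ, C, hK, hT⟩ := isContractingTower hξ hω hω0 ha0 ha1 hP
  obtain ⟨K', hK', hF⟩ := hg.exists_isRegularFamily hK hξ hω ha0.le ha1.le
  rw [tendsto_atTop] at h
  push Not at h
  obtain ⟨B, hB⟩ := h
  refine hT.exists_integral_sum_sq_le_of_frequently hK' hF
    (integral_centre hξ hω ha0.le ha1.le hg) (B := B ^ 2) (hB.mono fun n hn => ?_)
  have h1 := sigma_sq hξ hω ha0.le ha1.le hg n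
  have h2 : 0 ≤ sigma μ ξ g n := ENNReal.toReal_nonneg
  refine h1.symm.trans_le ?_
  gcongr

/-- Tightness is assumed for the uncentred sums. Their means act as translations, which do not
affect the modulus of a characteristic function. -/
theorem centredSumsBounded_of_tight (hξ : IsMarkovChain μ ξ P) (hω : UnitModulus X ω)
    (hω0 : ω 0 = 0) (ha0 : 0 < a) (ha1 : a < 1) (hP : EquicontinuousKernels ω P)
    {g : (j : ℕ) → Path X j → ℝ} (hg : UniformlyBounded ω a μ ξ g)
    (h : IsTightMeasureSet ((fun n : ℕ => μ.map (partialSum ξ g n)) '' Set.Ici 1)) :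
    CentredSumsBounded μ ξ g := by
  obtain ⟨K, θ, C, hK, hT⟩ := isContractingTower hξ hω hω0 ha0 ha1 hP
  obtain ⟨K', hK', hF⟩ := hg.exists_isRegularFamily hK hξ hω ha0.le ha1.le
  rw [isTightMeasureSet_map_iff (hg.measurable_partialSum hξ)] at h
  obtain ⟨R, hR0, hR⟩ := h (1 / 4) (by norm_num)
  refine hT.exists_integral_sum_sq_le_of_tight hK' hF
    (integral_centre hξ hω ha0.le ha1.le hg)
    (fun n => ∑ j ∈ Finset.range n, ∫ y, g j y ∂pathLaw μ ξ j) hR0 fun n hn => ?_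
  have e : ∀ w, (∑ j ∈ Finset.range n, ∫ y, g j y ∂pathLaw μ ξ j)
      + partialSum ξ (centre μ ξ g) n w = partialSum ξ g n w := fun w => by
    rw [partialSum_centre]; ring
  have h1 := hR n hn
  simp only [← e] at h1
  exact h1

variable {f : (j : ℕ) → Path X j → ℝ}

/-- The steps of the reductions of a sequence whose variances grow are bounded. -/
theorem exists_reductionSteps_bound (hξ : IsMarkovChain μ ξ P) (hω : UnitModulus X ω)
    (hω0 : ω 0 = 0) (ha0 : 0 < a) (ha1 : a < 1) (hP : EquicontinuousKernels ω P)
    (hf : UniformlyBounded ω a μ ξ f) (hσ : Tendsto (sigma μ ξ f) atTop atTop) :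
    ∃ t₀ > 0, ∀ r ∈ reductionSteps ω a μ ξ f, t₀ < |1 / r| := by
  obtain ⟨K, θ, C, hK, hT⟩ := isContractingTower hξ hω hω0 ha0 ha1 hP
  obtain ⟨K', hK', hF⟩ := hf.exists_isRegularFamily hK hξ hω ha0.le ha1.le
  obtain ⟨t₀, ht₀, h⟩ := hT.exists_frequency_bound hK' hF (integral_centre hξ hω ha0.le ha1.le hf)
  have hπ := Real.pi_pos
  refine ⟨t₀ / (2 * Real.pi), by positivity, ?_⟩
  rintro r ⟨hr0, H, Z, hred⟩
  by_contra hc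
  have hH := hred.bounded
  obtain ⟨K'', hK'', hH'⟩ := hH.exists_isRegularFamily hK hξ hω ha0.le ha1.le
  refine (CentredSumsBounded.not_tendsto_sigma hξ hω ha0.le ha1.le hf ?_) hσ
  -- At this frequency the integer part `r * Z` contributes a multiple of `2π`, so `f` and `H` have
  -- equal phases up to their means.
  refine h (2 * Real.pi / r) (by positivity) ?_ (centre μ ξ H) K''
    (fun j => ∫ y, H j y ∂pathLaw μ ξ j) hK'' hH' (integral_centre hξ hω ha0.le ha1.le hH)
    (centredSumsBounded_of_tight hξ hω hω0 ha0 ha1 hP hH hred.tight) fun j x => ?_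
  · rw [not_lt, le_div_iff₀ (by positivity)] at hc
    rw [div_eq_mul_one_div, abs_mul, abs_of_pos (by positivity), mul_comm]
    exact hc
  · have e : 2 * Real.pi / r * centre μ ξ f j x
        = 2 * Real.pi / r * H j x + (Z j x : ℝ) * (2 * Real.pi) := by
      rw [centre, hred.eq j x]; field_simp; ring
    have e2 : phase ((Z j x : ℝ) * (2 * Real.pi)) = 1 := by
      rw [phase, ← Complex.exp_int_mul_two_pi_mul_I (Z j x)]
      congr 1; push_cast; ring
    rw [e, phase_add, e2, mul_one, centre, sub_add_cancel]

theorem partialSum_linear_combination (g g' : (j : ℕ) → Path X j → ℝ) (b b' : ℝ) (n : ℕ) :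
    partialSum ξ (fun j x => b * g j x + b' * g' j x) n
      = fun w => b * partialSum ξ g n w + b' * partialSum ξ g' n w := by
  funext w
  simp only [partialSum, Finset.sum_add_distrib, Finset.mul_sum]

/-- The reciprocals of the reduction steps, together with `0`, form a group. -/
def corangeSubgroup (hξ : IsMarkovChain μ ξ P) (hω : UnitModulus X ω)
    (ha0 : 0 < a) (ha1 : a < 1) (f : (j : ℕ) → Path X j → ℝ) : AddSubgroup ℝ where
  carrier := corange ω a μ ξ f
  zero_mem' := Or.inr rfl
  neg_mem' := by
    rintro _ (⟨r, ⟨hr0, H, Z, hred⟩, rfl⟩ | rfl)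
    · refine Or.inl ⟨-r, ⟨neg_ne_zero.2 hr0, H, fun j x => -Z j x, hred.bounded, hred.tight,
        fun j x => ?_⟩, by field_simp⟩
      rw [hred.eq j x]
      push_cast
      ring
    · exact Or.inr (by simp)
  add_mem' := by
    rintro _ _ (⟨r, ⟨hr0, H, Z, hred⟩, rfl⟩ | rfl) (⟨r', ⟨hr0', H', Z', hred'⟩, rfl⟩ | rfl)
    · by_cases h0 : 1 / r + 1 / r' = 0
      · exact Or.inr h0
      -- The weights `s / r` and `s / r'` add up to one, and each turns its own step into `s`.
      · set s := (1 / r + 1 / r')⁻¹ with hs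
        have hs0 : s ≠ 0 := inv_ne_zero h0
        refine Or.inl ⟨s, ⟨hs0, fun j x => s / r * H j x + s / r' * H' j x,
          fun j x => Z j x + Z' j x, hred.bounded.linear_combination hξ hω ha0.le ha1.le
            hred'.bounded _ _, ?_, fun j x => ?_⟩, by rw [hs, one_div (_)⁻¹, inv_inv]⟩
        · simp only [partialSum_linear_combination]
          exact tight_linear_combination (hred.bounded.measurable_partialSum hξ)
            (hred'.bounded.measurable_partialSum hξ) hred.tight hred'.tight _ _
        · have h1 := hred.eq j x
          have h2 := hred'.eq j x
          have h3 : s / r + s / r' = 1 := by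
            rw [div_eq_mul_one_div s r, div_eq_mul_one_div s r', ← mul_add, hs,
              inv_mul_cancel₀ h0]
          have h4 : s / r * r = s := div_mul_cancel₀ _ hr0
          have h5 : s / r' * r' = s := div_mul_cancel₀ _ hr0'
          push_cast
          linear_combination (-h3) * (f j x - ∫ y, f j y ∂pathLaw μ ξ j)
            + s / r * h1 + s / r' * h2 + (Z j x : ℝ) * h4 + (Z' j x : ℝ) * h5
    · exact Or.inl ⟨r, ⟨hr0, H, Z, hred⟩, by simp⟩
    · exact Or.inl ⟨r', ⟨hr0', H', Z', hred'⟩, by simp⟩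
    · exact Or.inr (by simp)

/-- Reducing the integer part of a reduction again gives a reduction with the product step. -/
theorem mul_mem_reductionSteps (hξ : IsMarkovChain μ ξ P) (hω : UnitModulus X ω)
    (hω0 : ω 0 = 0) (ha0 : 0 < a) (ha1 : a < 1) (hP : EquicontinuousKernels ω P)
    (hf : UniformlyBounded ω a μ ξ f) {r h : ℝ} (hr : r ≠ 0) (hh : h ≠ 0)
    {H H' : (j : ℕ) → Path X j → ℝ} {Z Z' : (j : ℕ) → Path X j → ℤ}
    (hred : IsReduction ω a μ ξ f r H Z)
    (hred' : IsReduction ω a μ ξ (fun j x => (Z j x : ℝ)) h H' Z') :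
    r * h ∈ reductionSteps ω a μ ξ f := by
  have hHb := hred.bounded
  have hHc := hHb.centre hξ hω ha0.le ha1.le
  have hbd := centredSumsBounded_of_tight hξ hω hω0 ha0 ha1 hP hHb hred.tight
  -- Substituting the second reduction into the first produces the constant `r * κ(Z) = -κ(H)`,
  -- which centres `H`. The centred sums remain tight because tightness of the sums of `H` already
  -- forces bounded variances.
  refine ⟨mul_ne_zero hr hh, fun j x => 1 * centre μ ξ H j x + r * H' j x, Z',
    hHc.linear_combination hξ hω ha0.le ha1.le hred'.bounded _ _, ?_, fun j x => ?_⟩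
  · simp only [partialSum_linear_combination]
    exact tight_linear_combination (hHc.measurable_partialSum hξ)
      (hred'.bounded.measurable_partialSum hξ)
      (hbd.tight hξ hω ha0.le ha1.le hHb) hred'.tight _ _
  · have := hξ.isProbabilityMeasure_pathLaw j
    have hfi := hf.integrable hξ hω ha0.le ha1.le j
    have hHi := hHb.integrable hξ hω ha0.le ha1.le j
    have h1 := hred.eq j x
    have h2 := hred'.eq j x
    have h3 : r * ∫ y, (Z j y : ℝ) ∂pathLaw μ ξ j = - ∫ y, H j y ∂pathLaw μ ξ j := by
      have e : ∀ y, r * (Z j y : ℝ) = f j y - (∫ y, f j y ∂pathLaw μ ξ j) - H j y := fun y => by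
        rw [hred.eq j y]; ring
      rw [← integral_const_mul]
      simp only [e]
      have hi : Integrable (fun y => f j y - ∫ y, f j y ∂pathLaw μ ξ j) (pathLaw μ ξ j) :=
        hfi.sub (integrable_const _)
      rw [integral_sub hi hHi, integral_sub hfi (integrable_const _)]
      simp
    simp only [centre]
    linear_combination h1 + r * h2 + h3

end Reduction

end MarkovShift

end

/-! ### The three assertions -/

theorem mainTheorem5
    {X : ℕ → Type*} [∀ j, MetricSpace (X j)] [∀ j, MeasurableSpace (X j)] [∀ j, BorelSpace (X j)]
    (hdiam : ∀ (j : ℕ) (x y : X j), dist x y ≤ 1)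
    (ω : ℝ → ℝ) (hω : ∀ u ∈ Set.Icc (0 : ℝ) 1, ω u ∈ Set.Icc (0 : ℝ) 1) (hω_zero : ω 0 = 0)
    (hω_cont : ContinuousWithinAt ω (Set.Icc 0 1) 0)
    (a : ℝ) (ha : a ∈ Set.Ioo (0 : ℝ) 1)
    {Ω : Type*} [MeasurableSpace Ω] (μ : Measure Ω) [IsProbabilityMeasure μ]
    (ξ : (j : ℕ) → Ω → X j)
    (P : (j : ℕ) → Kernel (X (j + 1)) (X j)) [∀ j, IsMarkovKernel (P j)]
    (hξ : IsMarkovChain μ ξ P)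
    (hP_cont : EquicontinuousKernels ω P)
    (hP_ball : PositiveBalls ω P)
    (f : (j : ℕ) → Path X j → ℝ) (hf : UniformlyBounded ω a μ ξ f) :
    (¬ Tendsto (sigma μ ξ f) atTop atTop → corange ω a μ ξ f = Set.univ) ∧
    (¬ IsReducible ω a μ ξ f → corange ω a μ ξ f = {0}) ∧
    (IsReducible ω a μ ξ f → Tendsto (sigma μ ξ f) atTop atTop →
      ∃ h₀ : ℝ, 0 < h₀ ∧
        corange ω a μ ξ f = {t : ℝ | ∃ m : ℤ, t = h₀ * m} ∧
        IsGreatest {r : ℝ | 0 < r ∧ r ∈ reductionSteps ω a μ ξ f} (1 / h₀) ∧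
        ∃ (H : (j : ℕ) → Path X j → ℝ) (Z : (j : ℕ) → Path X j → ℤ),
          IsReduction ω a μ ξ f (1 / h₀) H Z ∧ ¬ IsReducibleInt ω a μ ξ Z) := by
  have hU : UnitModulus X ω := fun j x y => hω _ ⟨dist_nonneg, hdiam j x y⟩
  have ha0 := ha.1
  have ha1 := ha.2
  refine ⟨fun hσ => ?_, fun hirr => ?_, fun hred hσ => ?_⟩
  · have hbd := centredSumsBounded_of_not_tendsto hξ hU hω_zero ha0 ha1 hP_cont hf hσ
    refine Set.eq_univ_of_forall fun t => ?_
    by_cases ht : t = 0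
    · exact Or.inr ht
    -- The whole centred sequence goes into the tight part and the integer part is zero, so every
    -- step is admissible.
    · exact Or.inl ⟨1 / t, ⟨one_div_ne_zero ht, centre μ ξ f, fun _ _ => 0,
        hf.centre hξ hU ha0.le ha1.le, hbd.tight hξ hU ha0.le ha1.le hf,
        fun j x => by simp [centre]⟩, by simp⟩
  · have : reductionSteps ω a μ ξ f = ∅ :=
      Set.eq_empty_of_forall_notMem fun r hr => hirr ⟨r, hr⟩
    simp [corange, this]
  · obtain ⟨t₀, ht₀, hbound⟩ := exists_reductionSteps_bound hξ hU hω_zero ha0 ha1 hP_cont hf hσ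
    -- A subgroup of `ℝ` with no element in `(0, t₀)` is cyclic; the sign of the generator is then
    -- removed by `|b|`.
    obtain ⟨b, hb⟩ := AddSubgroup.cyclic_of_isolated_zero
      (H := corangeSubgroup hξ hU ha0 ha1 f) ht₀ (by
        rw [Set.disjoint_left]
        rintro t (⟨r, hr, rfl⟩ | rfl) ht
        · have := hbound r hr
          rw [abs_of_pos ht.1] at this
          exact absurd ht.2 (not_lt.2 this.le)
        · exact lt_irrefl _ ht.1)
    have hmem : ∀ t, t ∈ corange ω a μ ξ f ↔ ∃ m : ℤ, t = |b| * m := fun t => by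
      have h1 : t ∈ corange ω a μ ξ f ↔ t ∈ AddSubgroup.closure {b} := by rw [← hb]; rfl
      rw [h1, AddSubgroup.mem_closure_singleton]
      rcases abs_choice b with h2 | h2 <;> rw [h2]
      · exact ⟨fun ⟨m, hm⟩ => ⟨m, by rw [← hm, zsmul_eq_mul, mul_comm]⟩,
          fun ⟨m, hm⟩ => ⟨m, by rw [hm, zsmul_eq_mul, mul_comm]⟩⟩
      · exact ⟨fun ⟨m, hm⟩ => ⟨-m, by rw [← hm, zsmul_eq_mul]; push_cast; ring⟩,
          fun ⟨m, hm⟩ => ⟨-m, by rw [hm, zsmul_eq_mul]; push_cast; ring⟩⟩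
    have hb0 : 0 < |b| := by
      obtain ⟨r, hr⟩ := hred
      obtain ⟨m, hm⟩ := (hmem (1 / r)).1 (Or.inl ⟨r, hr, rfl⟩)
      refine (abs_nonneg b).lt_of_ne fun h => ?_
      rw [← h, zero_mul] at hm
      exact one_div_ne_zero hr.1 hm
    have hstep : 1 / |b| ∈ reductionSteps ω a μ ξ f := by
      rcases (hmem |b|).2 ⟨1, by simp⟩ with ⟨r, hr, h⟩ | h
      · rw [h, one_div_one_div]; exact hr
      · exact absurd h hb0.ne'
    have hgreat : IsGreatest {r : ℝ | 0 < r ∧ r ∈ reductionSteps ω a μ ξ f} (1 / |b|) := by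
      refine ⟨⟨one_div_pos.2 hb0, hstep⟩, ?_⟩
      rintro r ⟨hr0, hr⟩
      -- The reciprocal of a positive step is a positive integer multiple of `|b|`, hence at least
      -- `|b|`.
      obtain ⟨m, hm⟩ := (hmem (1 / r)).1 (Or.inl ⟨r, hr, rfl⟩)
      have hm0 : (0 : ℝ) < m := by
        have : 0 < |b| * m := hm ▸ one_div_pos.2 hr0
        exact pos_of_mul_pos_right this hb0.le
      have hm1 : (1 : ℝ) ≤ m := by exact_mod_cast Int.add_one_le_iff.2 (Int.cast_pos.1 hm0)
      rw [le_one_div hr0 hb0, hm]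
      exact le_mul_of_one_le_right hb0.le hm1
    refine ⟨|b|, hb0, Set.ext hmem, hgreat, ?_⟩
    obtain ⟨-, H, Z, hHZ⟩ := hstep
    refine ⟨H, Z, hHZ, ?_⟩
    rintro ⟨h, hh, H', Z', hHZ'⟩
    have h0 : 0 < h := one_pos.trans hh
    -- A reduction of `Z` with step `h > 1` would give `f` the step `h / |b|`, larger than the
    -- greatest one.
    have hmul := mul_mem_reductionSteps hξ hU hω_zero ha0 ha1 hP_cont hf
      (one_div_pos.2 hb0).ne' h0.ne' hHZ hHZ'
    have := hgreat.2 ⟨mul_pos (one_div_pos.2 hb0) h0, hmul⟩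
    exact absurd (lt_mul_of_one_lt_right (one_div_pos.2 hb0) hh) (not_lt.2 this)
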